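/- An instance of weighted bipartite matching with lower and upper quotas consists of finite sets $A$ of $n$ applicants and $P$ of $m$ projects, a bipartite graph $G=(A\,\dot\cup\,P,E)$, quotas $\ell,u\colon P\to\mathbb N$ and weights $w\colon E\to\mathbb R$. For $M\subseteq E$ and $p\in P$ let $M(p)=\{a\in A:\{a,p\}\in M\}$; the project $p$ is closed in $M$ if $|M(p)|=0$ and open in $M$ if $\ell_p\le |M(p)|\le u_p$. A matching is a set $M\subseteq E$ such that every applicant is incident to at most one edge of $M$ and every project is closed or open in $M$. A matching $M$ opens exactly the projects in $P_{\mathrm{open}}\subseteq P$ if every $p\in P_{\mathrm{open}}$ is open in $M$ and every $p\in P\setminus P_{\mathrm{open}}$ is closed in $M$. Theorem. There is an algorithm that, given such an instance and a set $P_{\mathrm{open}}\subseteq P$, finds in polynomial time a matching $M$ whose weight $\sum_{e\in M}w(e)$ is maximum among all matchings that open exactly the projects in $P_{\mathrm{open}}$, or reports that no matching opens exactly the projects in $P_{\mathrm{open}}$. Precisely, there are one fixed program for a random-access machine over natural and real numbers, whose only arithmetic operations are addition and subtraction (truncated at $0$ on natural numbers), whose only tests are Boolean combinations of comparisons, which has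 no real constant other than $0$ and no conversion of reals to natural numbers, and in which every elementary operation costs one step, and one polynomial $q$, such that on every input the program halts with a correct answer after at most $q(n+m)$ steps. -/

import Mathlib

/-!
# Machine model

A real random-access machine, programmed in a small imperative language.  The memory consists of
unbounded two-dimensional arrays of natural numbers and of real numbers, with indirect addressing.
The only arithmetic operations are addition and subtraction, the only tests are comparisons, the
only real constant is `0`, and there is no conversion from reals to natural numbers.  Every
arithmetic operation, memory access, comparison and control-flow step costs one unit of time.

Without multiplication a run of `t` steps on rational inputs only produces numbers whose bit length
is bounded by a polynomial in `t` and in the bit length of the input, so polynomially many steps of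
this machine amount to polynomial time on a Turing machine for rational inputs.
-/

namespace RealRAM

/-- Memory: `s.nat k i j` is the cell `(i, j)` of the `k`-th array of natural numbers,
`s.real k i j` the cell `(i, j)` of the `k`-th array of real numbers. -/
@[ext]
structure Mem where
  nat : ℕ → ℕ → ℕ → ℕ
  real : ℕ → ℕ → ℕ → ℝ

/-- Overwrite one cell of an array of natural numbers. -/
def Mem.setNat (s : Mem) (k i j v : ℕ) : Mem where
  nat k' i' j' := if k' = k ∧ i' = i ∧ j' = j then v else s.nat k' i' j'
  real := s.real

/-- Overwrite one cell of an array of real numbers. -/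
noncomputable def Mem.setReal (s : Mem) (k i j : ℕ) (v : ℝ) : Mem where
  nat := s.nat
  real k' i' j' := if k' = k ∧ i' = i ∧ j' = j then v else s.real k' i' j'

/-- Expressions of natural-number type. -/
inductive NExp where
  | const (c : ℕ)
  | get (k : ℕ) (i j : NExp)
  | add (x y : NExp)
  | sub (x y : NExp)

/-- Value of an expression; subtraction is truncated at `0`. -/
def NExp.eval (s : Mem) : NExp → ℕ
  | const c => c
  | get k i j => s.nat k (i.eval s) (j.eval s)
  | add x y => x.eval s + y.eval s
  | sub x y => x.eval s - y.eval s

/-- Number of elementary operations needed to evaluate an expression. -/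
def NExp.cost : NExp → ℕ
  | const _ => 1
  | get _ i j => i.cost + j.cost + 1
  | add x y => x.cost + y.cost + 1
  | sub x y => x.cost + y.cost + 1

/-- Expressions of real type. -/
inductive RExp where
  | zero
  | get (k : ℕ) (i j : NExp)
  | add (x y : RExp)
  | sub (x y : RExp)

/-- Value of an expression of real type. -/
noncomputable def RExp.eval (s : Mem) : RExp → ℝ
  | zero => 0
  | get k i j => s.real k (i.eval s) (j.eval s)
  | add x y => x.eval s + y.eval s
  | sub x y => x.eval s - y.eval s

/-- Number of elementary operations needed to evaluate an expression. -/
def RExp.cost : RExp → ℕ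
  | zero => 1
  | get _ i j => i.cost + j.cost + 1
  | add x y => x.cost + y.cost + 1
  | sub x y => x.cost + y.cost + 1

/-- Tests. -/
inductive BExp where
  | natLE (x y : NExp)
  | realLE (x y : RExp)
  | not (b : BExp)
  | and (b c : BExp)

/-- Truth of a test in a given memory. -/
def BExp.Holds (s : Mem) : BExp → Prop
  | natLE x y => x.eval s ≤ y.eval s
  | realLE x y => x.eval s ≤ y.eval s
  | not b => ¬ b.Holds s
  | and b c => b.Holds s ∧ c.Holds s

/-- Number of elementary operations needed to evaluate a test. -/
def BExp.cost : BExp → ℕ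
  | natLE x y => x.cost + y.cost + 1
  | realLE x y => x.cost + y.cost + 1
  | not b => b.cost + 1
  | and b c => b.cost + c.cost + 1

/-- Programs. -/
inductive Prog where
  | skip
  | setNat (k : ℕ) (i j : NExp) (e : NExp)
  | setReal (k : ℕ) (i j : NExp) (e : RExp)
  | seq (c d : Prog)
  | ite (b : BExp) (c d : Prog)
  | while (b : BExp) (c : Prog)

/-- `Runs c s s' t`: started in memory `s`, the program `c` halts in memory `s'`
after exactly `t` steps. -/
inductive Runs : Prog → Mem → Mem → ℕ → Prop where
  | skip (s : Mem) : Runs .skip s s 1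
  | setNat (k : ℕ) (i j e : NExp) (s : Mem) :
      Runs (.setNat k i j e) s (s.setNat k (i.eval s) (j.eval s) (e.eval s))
        (i.cost + j.cost + e.cost + 1)
  | setReal (k : ℕ) (i j : NExp) (e : RExp) (s : Mem) :
      Runs (.setReal k i j e) s (s.setReal k (i.eval s) (j.eval s) (e.eval s))
        (i.cost + j.cost + e.cost + 1)
  | seq {c d : Prog} {s s' s'' : Mem} {t t' : ℕ} :
      Runs c s s' t → Runs d s' s'' t' → Runs (.seq c d) s s'' (t + t')
  | iteTrue {b : BExp} {c d : Prog} {s s' : Mem} {t : ℕ} :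
      b.Holds s → Runs c s s' t → Runs (.ite b c d) s s' (b.cost + 1 + t)
  | iteFalse {b : BExp} {c d : Prog} {s s' : Mem} {t : ℕ} :
      ¬ b.Holds s → Runs d s s' t → Runs (.ite b c d) s s' (b.cost + 1 + t)
  | whileTrue {b : BExp} {c : Prog} {s s' s'' : Mem} {t t' : ℕ} :
      b.Holds s → Runs c s s' t → Runs (.while b c) s' s'' t' →
        Runs (.while b c) s s'' (b.cost + 1 + t + t')
  | whileFalse {b : BExp} {c : Prog} {s : Mem} :
      ¬ b.Holds s → Runs (.while b c) s s (b.cost + 1)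

/-- The machine is deterministic: the final memory and the running time are determined by the
program and the initial memory. -/
theorem Runs.det {c : Prog} {s s₁ : Mem} {t₁ : ℕ} (h₁ : Runs c s s₁ t₁) :
    ∀ {s₂ : Mem} {t₂ : ℕ}, Runs c s s₂ t₂ → s₁ = s₂ ∧ t₁ = t₂ := by
  induction h₁ with
  | skip s => intro _ _ h; cases h; exact ⟨rfl, rfl⟩
  | setNat k i j e s => intro _ _ h; cases h; exact ⟨rfl, rfl⟩
  | setReal k i j e s => intro _ _ h; cases h; exact ⟨rfl, rfl⟩
  | seq _ _ ih ih' =>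
    intro _ _ h
    cases h with
    | seq h h' =>
      obtain ⟨rfl, rfl⟩ := ih h
      obtain ⟨rfl, rfl⟩ := ih' h'
      exact ⟨rfl, rfl⟩
  | iteTrue hb _ ih =>
    intro _ _ h
    cases h with
    | iteTrue _ h => obtain ⟨rfl, rfl⟩ := ih h; exact ⟨rfl, rfl⟩
    | iteFalse hb' _ => exact absurd hb hb'
  | iteFalse hb _ ih =>
    intro _ _ h
    cases h with
    | iteTrue hb' _ => exact absurd hb' hb
    | iteFalse _ h => obtain ⟨rfl, rfl⟩ := ih h; exact ⟨rfl, rfl⟩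
  | whileTrue hb _ _ ih ih' =>
    intro _ _ h
    cases h with
    | whileTrue _ h h' =>
      obtain ⟨rfl, rfl⟩ := ih h
      obtain ⟨rfl, rfl⟩ := ih' h'
      exact ⟨rfl, rfl⟩
    | whileFalse hb' => exact absurd hb hb'
  | whileFalse hb =>
    intro _ _ h
    cases h with
    | whileTrue hb' _ _ => exact absurd hb' hb
    | whileFalse _ => exact ⟨rfl, rfl⟩

end RealRAM

/-!
# Weighted bipartite matching with lower and upper quotas
-/

/-- An instance with applicants `Fin n` and projects `Fin m`: a bipartite graph given by its edges,
a lower and an upper quota for each project, and a real weight for each edge. -/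
structure WHA (n m : ℕ) where
  edges : Finset (Fin n × Fin m)
  lower : Fin m → ℕ
  upper : Fin m → ℕ
  weight : {e : Fin n × Fin m // e ∈ edges} → ℝ

namespace WHA

variable {n m : ℕ}

/-- `M(p)`: the applicants assigned to the project `p` by the edge set `M`. -/
def assigned (M : Finset (Fin n × Fin m)) (p : Fin m) : Finset (Fin n) :=
  {a | (a, p) ∈ M}

/-- The project `p` is closed in `M`. -/
def IsClosedIn (M : Finset (Fin n × Fin m)) (p : Fin m) : Prop :=
  (assigned M p).card = 0

/-- The project `p` is open in `M`. -/
def IsOpenIn (I : WHA n m) (M : Finset (Fin n × Fin m)) (p : Fin m) : Prop :=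
  I.lower p ≤ (assigned M p).card ∧ (assigned M p).card ≤ I.upper p

/-- Matchings: sets of edges in which each applicant is incident to at most one edge and each
project is closed or open. -/
structure IsMatching (I : WHA n m) (M : Finset (Fin n × Fin m)) : Prop where
  subset : M ⊆ I.edges
  applicant : ∀ (a : Fin n), ({p | (a, p) ∈ M} : Finset (Fin m)).card ≤ 1
  project : ∀ (p : Fin m), IsClosedIn M p ∨ I.IsOpenIn M p

/-- `M` opens exactly the projects in `S`: those in `S` are open, all others are closed. -/
def OpensExactly (I : WHA n m) (S : Finset (Fin m)) (M : Finset (Fin n × Fin m)) : Prop :=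
  (∀ p ∈ S, I.IsOpenIn M p) ∧ (∀ p ∉ S, IsClosedIn M p)

/-- Weight of a pair, extended by `0` to the pairs that are not edges. -/
noncomputable def weightFn (I : WHA n m) (e : Fin n × Fin m) : ℝ :=
  if h : e ∈ I.edges then I.weight ⟨e, h⟩ else 0

/-- Total weight of a set of edges. -/
noncomputable def totalWeight (I : WHA n m) (M : Finset (Fin n × Fin m)) : ℝ :=
  ∑ e ∈ M, I.weightFn e

/-- `M` is a maximum-weight matching among the matchings that open exactly the projects in `S`. -/
def IsMaxWeightOpening (I : WHA n m) (S : Finset (Fin m)) (M : Finset (Fin n × Fin m)) : Prop :=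
  (I.IsMatching M ∧ I.OpensExactly S M) ∧
    ∀ (M' : Finset (Fin n × Fin m)), I.IsMatching M' → I.OpensExactly S M' →
      I.totalWeight M' ≤ I.totalWeight M

open Classical in
/-- Initial memory for the instance `I` and the set `S`: `n` and `m` in array `0`, the adjacency
matrix in array `1`, lower quotas, upper quotas and the indicator of `S` in (row `0` of) arrays
`2`, `3` and `4`, the weights in real array `0`; every other cell is `0`. -/
noncomputable def input (I : WHA n m) (S : Finset (Fin m)) : RealRAM.Mem where
  nat k i j :=
    match k with
    | 0 => if i = 0 ∧ j = 0 then n else if i = 0 ∧ j = 1 then m else 0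
    | 1 => if h : i < n ∧ j < m then
        (if ((⟨i, h.1⟩, ⟨j, h.2⟩) : Fin n × Fin m) ∈ I.edges then 1 else 0) else 0
    | 2 => if h : i = 0 ∧ j < m then I.lower ⟨j, h.2⟩ else 0
    | 3 => if h : i = 0 ∧ j < m then I.upper ⟨j, h.2⟩ else 0
    | 4 => if h : i = 0 ∧ j < m then (if (⟨j, h.2⟩ : Fin m) ∈ S then 1 else 0) else 0
    | _ => 0
  real k i j :=
    if h : k = 0 ∧ i < n ∧ j < m then I.weightFn (⟨i, h.2.1⟩, ⟨j, h.2.2⟩) else 0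

/-- The answer flag (array `5`): `1` for "found", `0` for "there is none". -/
def answer (s : RealRAM.Mem) : ℕ := s.nat 5 0 0

/-- The edge set that is written into array `6` as an incidence matrix. -/
def output (n m : ℕ) (s : RealRAM.Mem) : Finset (Fin n × Fin m) :=
  {e | s.nat 6 e.1 e.2 = 1}

end WHA

/-! Since the set of open projects is fixed, the quotas become slots. Each project has `n + 1`
slots. Slots of open projects with index below the upper quota accept adjacent applicants; those
with index below the lower quota must receive one; every slot that need not be filled also accepts a
private null column of weight `0`. Injective assignments of admissible columns to all slots yield
exactly the matchings that open the prescribed projects, with the same weight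
(`slotMatching_opensExactly`, `exists_slots`, `sum_slotWeight`).

A heaviest assignment is found by the Hungarian method. The invariant `Matched` couples an injective
assignment of the first `r` rows with column prices that are nonnegative, vanish on unmatched
columns, and make the column of every row maximize weight minus price. Weak duality
(`Matched.sum_le`) shows that such prices certify optimality, whatever the signs of the weights. A
new row starts on a virtual column, from which a tree of tight alternating steps grows. Raising the
prices of the visited columns by the least slack makes one more column reachable (`Search.step`). If
no candidate is left, the rows of the tree outnumber their admissible columns, so Hall's condition
fails (`Search.not_exists`). If an unmatched column is reached, the rows on the tree path are
shifted (`Augment.step`), and the virtual column becomes free.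

Prices and slacks need only additions, subtractions and comparisons. With `D` a quadratic bound in
`n + m` on the numbers of rows and columns, there are at most `D` insertions of `O(D)` search steps,
each scanning `O(D ^ 2)` pairs. Correctness and running time are proved together by a Hoare
calculus, `WP`. -/

namespace RealRAM

/-! ### Hoare rules for total correctness with step counts -/

/-- Total correctness with a time bound: started in `s`, the program `c` halts after at most `T`
steps in a memory satisfying `Q`. -/
def WP (c : Prog) (T : ℕ) (Q : Mem → Prop) (s : Mem) : Prop :=
  ∃ s' t, Runs c s s' t ∧ t ≤ T ∧ Q s'

theorem WP.mono {c : Prog} {T T' : ℕ} {Q Q' : Mem → Prop} {s : Mem} (h : WP c T Q s)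
    (hT : T ≤ T') (hQ : ∀ s', Q s' → Q' s') : WP c T' Q' s := by
  obtain ⟨s', t, hr, ht, hq⟩ := h
  exact ⟨s', t, hr, ht.trans hT, hQ _ hq⟩

theorem WP.skip {Q : Mem → Prop} {s : Mem} {T : ℕ} (h : Q s) (hT : 1 ≤ T) : WP .skip T Q s :=
  ⟨s, 1, .skip s, hT, h⟩

theorem WP.setNat {k : ℕ} {i j e : NExp} {Q : Mem → Prop} {s : Mem} {T : ℕ}
    (h : Q (s.setNat k (i.eval s) (j.eval s) (e.eval s)))
    (hT : i.cost + j.cost + e.cost + 1 ≤ T) : WP (.setNat k i j e) T Q s :=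
  ⟨_, _, .setNat k i j e s, hT, h⟩

theorem WP.setReal {k : ℕ} {i j : NExp} {e : RExp} {Q : Mem → Prop} {s : Mem} {T : ℕ}
    (h : Q (s.setReal k (i.eval s) (j.eval s) (e.eval s)))
    (hT : i.cost + j.cost + e.cost + 1 ≤ T) : WP (.setReal k i j e) T Q s :=
  ⟨_, _, .setReal k i j e s, hT, h⟩

theorem WP.seq {c d : Prog} {T T' : ℕ} {Q : Mem → Prop} {s : Mem}
    (h : WP c T (WP d T' Q) s) : WP (.seq c d) (T + T') Q s := by
  obtain ⟨s', t, hr, ht, s'', t', hr', ht', hq⟩ := h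
  exact ⟨s'', t + t', .seq hr hr', by omega, hq⟩

theorem WP.ite {b : BExp} {c d : Prog} {T : ℕ} {Q : Mem → Prop} {s : Mem}
    (h : b.Holds s → WP c T Q s) (h' : ¬ b.Holds s → WP d T Q s) :
    WP (.ite b c d) (b.cost + 1 + T) Q s := by
  by_cases hb : b.Holds s
  · obtain ⟨s', t, hr, ht, hq⟩ := h hb
    exact ⟨s', _, .iteTrue hb hr, by omega, hq⟩
  · obtain ⟨s', t, hr, ht, hq⟩ := h' hb
    exact ⟨s', _, .iteFalse hb hr, by omega, hq⟩

/-- Loop rule: the invariant `I` carries a variant that decreases in each iteration. -/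
theorem WP.while {b : BExp} {c : Prog} {T : ℕ} (I : ℕ → Mem → Prop)
    (step : ∀ k s, I k s → b.Holds s → WP c T (fun s' => ∃ k' < k, I k' s') s) :
    ∀ (k : ℕ) (s : Mem), I k s →
      WP (.while b c) ((k + 1) * (b.cost + 1 + T)) (fun s' => (∃ k', I k' s') ∧ ¬ b.Holds s') s := by
  intro k
  induction k using Nat.strong_induction_on with
  | _ k ih =>
    intro s hI
    by_cases hb : b.Holds s
    · obtain ⟨s', t, hr, ht, k', hk', hI'⟩ := step k s hI hb
      obtain ⟨s'', t', hr', ht', hq⟩ := ih k' hk' s' hI'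
      refine ⟨s'', _, .whileTrue hb hr hr', ?_, hq⟩
      have : (k' + 1 + 1) * (b.cost + 1 + T) ≤ (k + 1) * (b.cost + 1 + T) :=
        Nat.mul_le_mul_right _ (by omega)
      rw [Nat.succ_mul] at this
      omega
    · refine ⟨s, _, .whileFalse hb, ?_, ⟨k, hI⟩, hb⟩
      rw [Nat.succ_mul]
      omega

/-- A scalar variable is cell `(0, 0)` of an array. -/
abbrev NExp.var (k : ℕ) : NExp := .get k (.const 0) (.const 0)

/-- Entry `j` of row `0` of an array. -/
abbrev NExp.at (k : ℕ) (j : NExp) : NExp := .get k (.const 0) j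

/-- Assignment to a scalar variable. -/
abbrev Prog.assign (k : ℕ) (e : NExp) : Prog := .setNat k (.const 0) (.const 0) e

/-- Assignment to an entry of row `0` of an array. -/
abbrev Prog.assignAt (k : ℕ) (j e : NExp) : Prog := .setNat k (.const 0) j e

/-- Strict comparison of natural numbers. -/
abbrev BExp.natLT (x y : NExp) : BExp := .not (.natLE y x)

/-- Strict comparison of real numbers. -/
abbrev BExp.realLT (x y : RExp) : BExp := .not (.realLE y x)

/-- Disjunction of tests. -/
abbrev BExp.or (b c : BExp) : BExp := .not (.and (.not b) (.not c))

/-- `for v < e do c`. -/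
abbrev Prog.for (v : ℕ) (e : NExp) (c : Prog) : Prog :=
  .seq (.assign v (.const 0))
    (.while (.natLT (.var v) e) (.seq c (.assign v (.add (.var v) (.const 1)))))

/-- The variant is `B - i`. The invariant is required after the counter has been overwritten, so it
may speak of the whole memory. The bound may depend on the memory as long as the invariant fixes its
value `B`. -/
theorem WP.for {v : ℕ} {e : NExp} {c : Prog} {T B : ℕ} (I : ℕ → Mem → Prop) {Q : Mem → Prop}
    {s : Mem} {T' : ℕ} (init : I 0 (s.setNat v 0 0 0))
    (bound : ∀ i s, I i s → e.eval s = B)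
    (step : ∀ i < B, ∀ s, I i s → s.nat v 0 0 = i →
      WP c T (fun s' => s'.nat v 0 0 = i ∧ I (i + 1) (s'.setNat v 0 0 (i + 1))) s)
    (post : ∀ s, s.nat v 0 0 = B → I B s → Q s)
    (hT : (B + 2) * (e.cost + T + 20) ≤ T') :
    WP (.for v e c) T' Q s := by
  have key := WP.while (b := .natLT (.var v) e)
    (c := .seq c (.assign v (.add (.var v) (.const 1)))) (T := T + 8)
    (fun k s => ∃ i, i + k = B ∧ s.nat v 0 0 = i ∧ I i s)
    (by
      rintro k s ⟨i, hi, hv, hI⟩ hb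
      simp only [BExp.Holds, NExp.eval, not_le, hv, bound i s hI] at hb
      -- The increment of the counter costs `8` steps.
      refine WP.mono (WP.seq (T' := 8) ((step i hb s hI hv).mono le_rfl ?_)) le_rfl fun _ h => h
      rintro s' ⟨hv', hI'⟩
      refine WP.setNat ⟨k - 1, by omega, i + 1, by omega, ?_, ?_⟩ (by simp [NExp.cost])
      · simp [Mem.setNat, NExp.eval, hv']
      · simpa [NExp.eval, hv'] using hI')
    B (s.setNat v 0 0 0) ⟨0, by omega, by simp [Mem.setNat], init⟩
  have h := WP.seq (c := .assign v (.const 0)) (T := 4) (s := s)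
    (WP.setNat (i := .const 0) (j := .const 0) (e := .const 0) key (by simp [NExp.cost]))
  refine h.mono ?_ ?_
  · simp only [BExp.cost, NExp.cost] at *
    refine le_trans ?_ hT
    nlinarith
  · rintro s' ⟨⟨k, i, hi, hv, hI⟩, hb⟩
    simp only [BExp.Holds, NExp.eval, not_le, hv, bound i s' hI] at hb
    obtain rfl : i = B := by omega
    exact post s' hv hI

/-! ### Reading memory after a write -/

section

variable (s : Mem) (k i j v : ℕ) (y : ℝ)

@[simp] theorem Mem.setNat_real : (s.setNat k i j v).real = s.real := rfl

@[simp] theorem Mem.setReal_nat : (s.setReal k i j y).nat = s.nat := rfl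

@[simp] theorem Mem.setNat_nat_of_ne {k' : ℕ} (h : k' ≠ k) :
    (s.setNat k i j v).nat k' = s.nat k' := by
  funext i' j'
  simp [Mem.setNat, h]

@[simp] theorem Mem.setReal_real_of_ne {k' : ℕ} (h : k' ≠ k) :
    (s.setReal k i j y).real k' = s.real k' := by
  funext i' j'
  simp [Mem.setReal, h]

@[simp] theorem Mem.setNat_nat_row :
    (s.setNat k i j v).nat k i = Function.update (s.nat k i) j v := by
  funext j'
  simp [Mem.setNat, Function.update_apply]

@[simp] theorem Mem.setReal_real_row :
    (s.setReal k i j y).real k i = Function.update (s.real k i) j y := by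
  funext j'
  simp [Mem.setReal, Function.update_apply]

theorem Mem.setNat_nat_self (i' j' : ℕ) :
    (s.setNat k i j v).nat k i' j' = if i' = i ∧ j' = j then v else s.nat k i' j' := by
  simp [Mem.setNat]

theorem Mem.setReal_real_self (i' j' : ℕ) :
    (s.setReal k i j y).real k i' j' = if i' = i ∧ j' = j then y else s.real k i' j' := by
  simp [Mem.setReal]

end

end RealRAM

/-!
# Row-perfect matchings of maximum weight

Rows `b < N` and columns `c < K`, all of them natural numbers; `adj b c` says that `b` may be
matched to `c`, with weight `w b c`.  Rows are inserted one at a time.  While row `r` is being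
inserted it is matched to the virtual column `K`.
-/

namespace RowMatching

variable {adj : ℕ → ℕ → Prop} {w : ℕ → ℕ → ℝ} {K r : ℕ} {x vis way mt : ℕ → ℕ} {π : ℕ → ℝ}

/-- `w b (x b) - π (x b)` is the largest value `w b c - π c` of an admissible column `c`. -/
def Best (adj : ℕ → ℕ → Prop) (w : ℕ → ℕ → ℝ) (K : ℕ) (x : ℕ → ℕ) (π : ℕ → ℝ) (b : ℕ) : Prop :=
  ∀ c < K, adj b c → w b c - π c ≤ w b (x b) - π (x b)

/-- The rows `b < r` are matched to the columns `x b`, and the column prices `π` certify that this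
matching has maximum weight; `mt` marks the matched columns. -/
structure Matched (adj : ℕ → ℕ → Prop) (w : ℕ → ℕ → ℝ) (K r : ℕ) (x mt : ℕ → ℕ) (π : ℕ → ℝ) :
    Prop where
  lt : ∀ b < r, x b < K
  allowed : ∀ b < r, adj b (x b)
  inj : ∀ b < r, ∀ b' < r, x b = x b' → b = b'
  mt_iff : ∀ c < K, mt c ≠ 0 ↔ ∃ b < r, x b = c
  nonneg : ∀ c < K, 0 ≤ π c
  zero : ∀ c < K, mt c = 0 → π c = 0
  best : ∀ b < r, Best adj w K x π b

/-- A column is reached from an earlier column by a tight alternating step. -/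
structure Reached (adj : ℕ → ℕ → Prop) (w : ℕ → ℕ → ℝ) (r : ℕ) (x vis way : ℕ → ℕ) (π : ℕ → ℝ)
    (c : ℕ) : Prop where
  le : way c ≤ r
  adj : adj (way c) c
  pos : vis (x (way c)) ≠ 0
  lt : vis (x (way c)) < vis c
  tight : w (way c) (x (way c)) - π (x (way c)) = w (way c) c - π c

/-- The search tree of row `r` after `k` columns other than `K` were visited; `vis c` is the time
of the visit and `way c` the row from which the column was reached. -/
structure Search (adj : ℕ → ℕ → Prop) (w : ℕ → ℕ → ℝ) (K r : ℕ) (x mt vis way : ℕ → ℕ)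
    (π : ℕ → ℝ) (k : ℕ) : Prop where
  matched : Matched adj w K r x mt π
  root : x r = K
  vis_root : vis K = 1
  vis_le : ∀ c < K, vis c ≤ k + 1
  reached : ∀ c < K, vis c ≠ 0 → Reached adj w r x vis way π c
  best_root : k ≠ 0 → Best adj w K x π r
  card : ({c ∈ Finset.range K | vis c ≠ 0} : Finset ℕ).card = k

/-- The price of the virtual column `K` and the array `way` are unconstrained, so values left over
from earlier insertions do no harm. -/
theorem Search.start (h : Matched adj w K r x mt π) (way : ℕ → ℕ) {vis : ℕ → ℕ}
    (hvis : ∀ c < K, vis c = 0) (hK : vis K = 1) (π' : ℕ → ℝ) (hπ : ∀ c < K, π' c = π c)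
    (x' : ℕ → ℕ) (hx : ∀ b < r, x' b = x b) (hr : x' r = K) :
    Search adj w K r x' mt vis way π' 0 where
  matched :=
    { lt := fun b hb => by rw [hx b hb]; exact h.lt b hb
      allowed := fun b hb => by rw [hx b hb]; exact h.allowed b hb
      inj := fun b hb b' hb' => by rw [hx b hb, hx b' hb']; exact h.inj b hb b' hb'
      mt_iff := fun c hc => by
        rw [h.mt_iff c hc]
        refine exists_congr fun b => and_congr_right fun hb => ?_
        rw [hx b hb]
      nonneg := fun c hc => by rw [hπ c hc]; exact h.nonneg c hc
      zero := fun c hc => by rw [hπ c hc]; exact h.zero c hc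
      best := fun b hb c hc hadj => by
        rw [hx b hb, hπ c hc, hπ _ (h.lt b hb)]; exact h.best b hb c hc hadj }
  root := hr
  vis_root := hK
  vis_le c hc := by rw [hvis c hc]; omega
  reached c hc h := absurd (hvis c hc) h
  best_root h := absurd rfl h
  card := by
    rw [Finset.card_eq_zero, Finset.filter_eq_empty_iff]
    intro c hc
    simp [hvis c (Finset.mem_range.1 hc)]

/-! ### Growing the tree by price updates -/

/-- The amount by which the admissible column `c` is worse for row `b` than its column `x b`. -/
def slack (w : ℕ → ℕ → ℝ) (x : ℕ → ℕ) (π : ℕ → ℝ) (b c : ℕ) : ℝ :=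
  (w b (x b) - π (x b)) - (w b c - π c)

/-- The pairs of a row of the search tree and an admissible column that was not visited. -/
def Candidate (adj : ℕ → ℕ → Prop) (K r : ℕ) (x vis : ℕ → ℕ) (b c : ℕ) : Prop :=
  b ≤ r ∧ c < K ∧ vis (x b) ≠ 0 ∧ vis c = 0 ∧ adj b c

/-- This bounds the number of search steps in one insertion. -/
theorem Search.le_card {k : ℕ} (h : Search adj w K r x mt vis way π k) : k ≤ K := by
  rw [← h.card]
  exact (Finset.card_filter_le _ _).trans (by simp)

theorem Search.x_le {k : ℕ} (h : Search adj w K r x mt vis way π k) {b : ℕ} (hb : b ≤ r) :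
    x b ≤ K := by
  rcases hb.lt_or_eq with hb | rfl
  · exact (h.matched.lt b hb).le
  · exact h.root.le

theorem Search.inj {k : ℕ} (h : Search adj w K r x mt vis way π k) {b b' : ℕ} (hb : b ≤ r)
    (hb' : b' ≤ r) (e : x b = x b') : b = b' := by
  rcases hb.lt_or_eq with hb | rfl <;> rcases hb'.lt_or_eq with hb' | rfl
  · exact h.matched.inj b hb b' hb' e
  · have := h.matched.lt b hb; have := h.root; omega
  · have := h.matched.lt b' hb'; have := h.root; omega
  · rfl

/-- Price update along a minimum slack, and visit of the column where it is attained. -/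
theorem Search.step {k : ℕ} (h : Search adj w K r x mt vis way π k)
    (hmt : ∀ c < K, vis c ≠ 0 → mt c ≠ 0) {b₀ c₀ : ℕ}
    (h₀ : Candidate adj K r x vis b₀ c₀)
    (hmin : ∀ b c, Candidate adj K r x vis b c → slack w x π b₀ c₀ ≤ slack w x π b c)
    {π' : ℕ → ℝ} (hπ : ∀ c ≤ K, π' c = if vis c ≠ 0 then π c + slack w x π b₀ c₀ else π c) :
    Search adj w K r x mt (Function.update vis c₀ (k + 2)) (Function.update way c₀ b₀) π'
      (k + 1) := by
  obtain ⟨hb₀, hc₀, hv₀, hn₀, ha₀⟩ := h₀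
  have hM := h.matched
  -- The first slack may be negative, because the price of `K` is arbitrary. This is harmless: when
  -- `k = 0` only `K` has been visited, so no price of a genuine column changes, and the update
  -- makes row `r` satisfy `Best`.
  have hδ : k ≠ 0 → 0 ≤ slack w x π b₀ c₀ := by
    intro hk
    have : Best adj w K x π b₀ := by
      rcases hb₀.lt_or_eq with hb | rfl
      · exact hM.best b₀ hb
      · exact h.best_root hk
    have := this c₀ hc₀ ha₀
    unfold slack
    linarith
  have hk0 : ∀ c < K, vis c ≠ 0 → k ≠ 0 := by
    rintro c hc hv rfl
    have := h.card
    rw [Finset.card_eq_zero, Finset.filter_eq_empty_iff] at this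
    exact this (Finset.mem_range.2 hc) hv
  -- Compare whether the column of `b` and the column `c` were visited. If both or neither were, the
  -- difference is unchanged. If only `c` was, its value drops. If only the column of `b` was, the
  -- value of that column drops by the minimum slack, which the pair `(b, c)` can afford.
  have hbest : ∀ b ≤ r, (b < r ∨ k ≠ 0 ∨ vis (x b) ≠ 0) → Best adj w K x π' b := by
    intro b hb hor c hc hadj
    rw [hπ c hc.le, hπ (x b) (h.x_le hb)]
    by_cases h1 : vis (x b) = 0
    · have hbr : b < r := by
        rcases hb.lt_or_eq with hb | rfl
        · exact hb
        · rw [h.root, h.vis_root] at h1; omega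
      have h3 := hM.best b hbr c hc hadj
      by_cases h2 : vis c = 0
      · simpa [h1, h2] using h3
      · have := hδ (hk0 c hc h2)
        simp only [h1, h2, ne_eq, not_true_eq_false, not_false_eq_true, if_true, if_false]
        linarith
    · by_cases h2 : vis c = 0
      · have := hmin b c ⟨hb, hc, h1, h2, hadj⟩
        simp only [h1, h2, ne_eq, not_true_eq_false, not_false_eq_true, if_true, if_false]
        unfold slack at this ⊢
        linarith
      · have hbb : Best adj w K x π b := by
          rcases hb.lt_or_eq with hb | rfl
          · exact hM.best b hb
          · exact h.best_root (hk0 c hc h2)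
        have := hbb c hc hadj
        simp only [h1, h2, ne_eq, not_false_eq_true, if_true]
        linarith
  have hne : ∀ c, vis c ≠ 0 → Function.update vis c₀ (k + 2) c = vis c := by
    intro c hc
    rw [Function.update_of_ne]
    rintro rfl
    exact hc hn₀
  have hvis : ∀ c ≤ K, vis c ≤ k + 1 := by
    intro c hc
    rcases hc.lt_or_eq with hc | rfl
    · exact h.vis_le c hc
    · rw [h.vis_root]; omega
  refine ⟨⟨hM.lt, hM.allowed, hM.inj, hM.mt_iff, ?_, ?_, fun b hb => hbest b hb.le (.inl hb)⟩,
    h.root, ?_, ?_, ?_, ?_, ?_⟩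
  · intro c hc
    rw [hπ c hc.le]
    split_ifs with hv
    · exact add_nonneg (hM.nonneg c hc) (hδ (hk0 c hc hv))
    · exact hM.nonneg c hc
  -- Only matched columns have been visited, so unmatched columns keep price `0`.
  · intro c hc h0
    rw [hπ c hc.le, if_neg (fun hv => hmt c hc hv h0), hM.zero c hc h0]
  · rw [hne K (by rw [h.vis_root]; omega), h.vis_root]
  · intro c hc
    by_cases hcc : c = c₀
    · subst hcc; simp
    · rw [Function.update_of_ne hcc]; have := h.vis_le c hc; omega
  · intro c hc hv
    by_cases hcc : c = c₀
    · subst hcc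
      have hle := hvis _ (h.x_le hb₀)
      refine ⟨by simpa using hb₀, by simpa using ha₀, ?_, ?_, ?_⟩
      · simpa [hne _ hv₀] using hv₀
      · simp only [Function.update_self, hne _ hv₀]; omega
      · simp only [Function.update_self]
        rw [hπ _ hc.le, hπ _ (h.x_le hb₀), if_pos hv₀, if_neg (by simpa using hn₀)]
        unfold slack
        ring
    · rw [Function.update_of_ne hcc] at hv
      have hR := h.reached c hc hv
      refine ⟨?_, ?_, ?_, ?_, ?_⟩ <;> rw [Function.update_of_ne hcc]
      · exact hR.le
      · exact hR.adj
      · rw [hne _ hR.pos]; exact hR.pos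
      · rw [hne _ hR.pos, Function.update_of_ne hcc]; exact hR.lt
      -- Both columns of an old tree step were visited, so their prices move together and the step
      -- stays tight.
      · rw [hπ c hc.le, hπ _ (h.x_le hR.le), if_pos hv, if_pos hR.pos]
        linarith [hR.tight]
  · intro _
    refine hbest r le_rfl (.inr (.inr ?_))
    rw [h.root, h.vis_root]; omega
  · have : ({c ∈ Finset.range K | Function.update vis c₀ (k + 2) c ≠ 0} : Finset ℕ)
        = insert c₀ {c ∈ Finset.range K | vis c ≠ 0} := by
      ext c
      simp only [Finset.mem_filter, Finset.mem_range, Finset.mem_insert]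
      by_cases hcc : c = c₀
      · subst hcc; simp [hc₀]
      · simp [hcc]
    rw [this, Finset.card_insert_of_notMem (by simp [hn₀]), h.card]

/-- If the search is stuck, then Hall's condition is violated. -/
theorem Search.not_exists {k : ℕ} (h : Search adj w K r x mt vis way π k)
    (hmt : ∀ c < K, vis c ≠ 0 → mt c ≠ 0) (hno : ∀ b c, ¬ Candidate adj K r x vis b c)
    (z : ℕ → ℕ) (hz : ∀ b ≤ r, z b < K ∧ adj b (z b)) :
    ¬ ∀ b ≤ r, ∀ b' ≤ r, z b = z b' → b = b' := by
  intro hinj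
  -- Without candidates, every column admissible for a row of the tree has been visited, so `z`
  -- injects these rows into the visited columns.
  have h1 : ({b ∈ Finset.range (r + 1) | vis (x b) ≠ 0} : Finset ℕ).card
      ≤ ({c ∈ Finset.range K | vis c ≠ 0} : Finset ℕ).card := by
    refine Finset.card_le_card_of_injOn z ?_ ?_
    · intro b hb
      simp only [Finset.coe_filter, Finset.mem_range, Set.mem_ofPred_eq] at hb ⊢
      obtain ⟨hzK, hza⟩ := hz b (by omega)
      refine ⟨hzK, fun h0 => hno b (z b) ⟨by omega, hzK, hb.2, h0, hza⟩⟩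
    · intro b hb b' hb' e
      simp only [Finset.coe_filter, Finset.mem_range, Set.mem_ofPred_eq] at hb hb'
      exact hinj b (by omega) b' (by omega) e
  -- Every visited column carries a row of the tree, and `K` carries row `r`: there is one row too
  -- many.
  have h2 : insert K ({c ∈ Finset.range K | vis c ≠ 0} : Finset ℕ)
      ⊆ ({b ∈ Finset.range (r + 1) | vis (x b) ≠ 0} : Finset ℕ).image x := by
    intro c hc
    simp only [Finset.mem_insert, Finset.mem_filter, Finset.mem_range, Finset.mem_image] at hc ⊢
    rcases hc with rfl | ⟨hc, hv⟩
    · exact ⟨r, ⟨by omega, by rw [h.root, h.vis_root]; omega⟩, h.root⟩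
    · obtain ⟨b, hb, rfl⟩ := (h.matched.mt_iff c hc).1 (hmt c hc hv)
      exact ⟨b, ⟨by omega, hv⟩, rfl⟩
  have h3 := (Finset.card_le_card h2).trans Finset.card_image_le
  rw [Finset.card_insert_of_notMem (by simp)] at h3
  omega

/-! ### Augmenting along the tree -/

/-- Augmentation along the search tree: `c` is the column that is currently free, `c₁` the one that
was free at the beginning. -/
structure Augment (adj : ℕ → ℕ → Prop) (w : ℕ → ℕ → ℝ) (K r : ℕ) (mt vis way : ℕ → ℕ)
    (π : ℕ → ℝ) (c₁ : ℕ) (x : ℕ → ℕ) (c : ℕ) : Prop where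
  vis_root : vis K = 1
  vis_pos : vis c ≠ 0
  le : c ≤ K
  free : ∀ b ≤ r, x b ≠ c
  inj : ∀ b ≤ r, ∀ b' ≤ r, x b = x b' → b = b'
  cols : ∀ b ≤ r, x b = K ∨ x b < K ∧ adj b (x b) ∧ (mt (x b) ≠ 0 ∨ x b = c₁)
  cover : ∀ c' < K, c' ≠ c → mt c' ≠ 0 ∨ c' = c₁ → ∃ b ≤ r, x b = c'
  best : ∀ b ≤ r, Best adj w K x π b
  reached : ∀ c' < K, vis c' ≠ 0 → vis c' ≤ vis c → Reached adj w r x vis way π c'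

theorem Search.augment {k c₁ : ℕ} (h : Search adj w K r x mt vis way π k) (hk : k ≠ 0)
    (hc : c₁ < K) (hv : vis c₁ ≠ 0) (hmt : mt c₁ = 0) :
    Augment adj w K r mt vis way π c₁ x c₁ := by
  have hM := h.matched
  refine ⟨h.vis_root, hv, hc.le, ?_, fun b hb b' hb' => h.inj hb hb', ?_, ?_, ?_,
    fun c' hc' hv' _ => h.reached c' hc' hv'⟩
  · rintro b hb rfl
    rcases hb.lt_or_eq with hb | rfl
    · exact (hM.mt_iff _ hc).2 ⟨b, hb, rfl⟩ hmt
    · exact hc.ne h.root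
  · intro b hb
    rcases hb.lt_or_eq with hb | rfl
    · exact .inr ⟨hM.lt b hb, hM.allowed b hb, .inl ((hM.mt_iff _ (hM.lt b hb)).2 ⟨b, hb, rfl⟩)⟩
    · exact .inl h.root
  · rintro c' hc' hne (hm | hm)
    · obtain ⟨b, hb, e⟩ := (hM.mt_iff c' hc').1 hm
      exact ⟨b, hb.le, e⟩
    · exact absurd hm hne
  · intro b hb
    rcases hb.lt_or_eq with hb | rfl
    · exact hM.best b hb
    · exact h.best_root hk

/-- The row `way c` moves to the free column `c` and frees its old column. The move is tight, so
`Best` survives. -/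
theorem Augment.step {c₁ c : ℕ} (h : Augment adj w K r mt vis way π c₁ x c) (hmt : mt c ≠ 0 ∨ c = c₁)
    (hc : c < K) :
    Augment adj w K r mt vis way π c₁ (Function.update x (way c) c) (x (way c)) ∧
      vis (x (way c)) < vis c ∧
      (x (way c) < K → mt (x (way c)) ≠ 0 ∨ x (way c) = c₁) := by
  have hR := h.reached c hc h.vis_pos le_rfl
  set b₀ := way c with hb₀
  have hup : ∀ b, b ≠ b₀ → Function.update x b₀ c b = x b := fun b hb =>
    Function.update_of_ne hb _ _
  have hcols := h.cols b₀ hR.le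
  refine ⟨⟨h.vis_root, hR.pos, ?_, ?_, ?_, ?_, ?_, ?_, ?_⟩, hR.lt, ?_⟩
  · rcases hcols with e | e
    · exact e.le
    · exact e.1.le
  · intro b hb
    by_cases hbb : b = b₀
    · subst hbb
      rw [Function.update_self]
      exact (h.free _ hb).symm
    · rw [hup b hbb]
      exact fun e => hbb (h.inj b hb b₀ hR.le e)
  · intro b hb b' hb' e
    by_cases h1 : b = b₀ <;> by_cases h2 : b' = b₀
    · rw [h1, h2]
    · rw [h1, Function.update_self, hup b' h2] at e
      exact absurd e.symm (h.free b' hb')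
    · rw [h2, Function.update_self, hup b h1] at e
      exact absurd e (h.free b hb)
    · rw [hup b h1, hup b' h2] at e
      exact h.inj b hb b' hb' e
  · intro b hb
    by_cases hbb : b = b₀
    · rw [hbb, Function.update_self]
      exact .inr ⟨hc, hR.adj, hmt⟩
    · rw [hup b hbb]
      exact h.cols b hb
  · intro c' hc' hne hm
    by_cases hcc : c' = c
    · exact ⟨b₀, hR.le, by rw [Function.update_self, hcc]⟩
    · obtain ⟨b, hb, rfl⟩ := h.cover c' hc' hcc hm
      refine ⟨b, hb, hup b ?_⟩
      rintro rfl
      exact hne rfl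
  · intro b hb c' hc' hadj
    by_cases hbb : b = b₀
    · rw [hbb, Function.update_self, hb₀, ← hR.tight]
      rw [hbb, hb₀] at hadj
      exact h.best _ hR.le c' hc' hadj
    · rw [hup b hbb]
      exact h.best b hb c' hc' hadj
  · intro c' hc' hv hle
    have hR' := h.reached c' hc' hv (hle.trans hR.lt.le)
    have hne : way c' ≠ b₀ := by
      -- Visiting times decrease towards the root, so the row that has just moved is not the parent
      -- of any column visited no later than the new free column. The remaining tree steps are
      -- therefore intact.
      intro e
      have := hR'.lt
      rw [e] at this
      omega
    refine ⟨hR'.le, hR'.adj, ?_, ?_, ?_⟩ <;> rw [hup _ hne]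
    · exact hR'.pos
    · exact hR'.lt
    · exact hR'.tight
  · intro hlt
    rcases hcols with e | e
    · omega
    · exact e.2.2

/-- Once `K` is the free column, all rows up to `r` sit on genuine columns, and `c₁` is the only
newly matched one. -/
theorem Augment.matched {c₁ : ℕ} (h : Augment adj w K r mt vis way π c₁ x K) (hc₁ : c₁ < K)
    (hnonneg : ∀ c < K, 0 ≤ π c) (hzero : ∀ c < K, mt c = 0 → π c = 0) :
    Matched adj w K (r + 1) x (Function.update mt c₁ 1) π := by
  have hcols : ∀ b ≤ r, x b < K ∧ adj b (x b) ∧ (mt (x b) ≠ 0 ∨ x b = c₁) := fun b hb =>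
    (h.cols b hb).resolve_left (h.free b hb)
  have hup : ∀ c, Function.update mt c₁ 1 c ≠ 0 ↔ mt c ≠ 0 ∨ c = c₁ := by
    intro c
    by_cases hc : c = c₁
    · subst hc; simp
    · simp [hc]
  refine ⟨fun b hb => (hcols b (by omega)).1, fun b hb => (hcols b (by omega)).2.1,
    fun b hb b' hb' => h.inj b (by omega) b' (by omega), ?_, hnonneg, ?_,
    fun b hb => h.best b (by omega)⟩
  · intro c hc
    rw [hup]
    constructor
    · intro hm
      obtain ⟨b, hb, e⟩ := h.cover c hc hc.ne hm
      exact ⟨b, by omega, e⟩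
    · rintro ⟨b, hb, rfl⟩
      exact (hcols b (by omega)).2.2
  · intro c hc h0
    refine hzero c hc ?_
    by_contra hne
    exact (hup c).2 (.inl hne) h0

/-! ### Optimality from prices -/

/-- Weak duality: a matching with certifying prices has maximum weight. -/
theorem Matched.sum_le (h : Matched adj w K r x mt π) (z : ℕ → ℕ)
    (hz : ∀ b < r, z b < K ∧ adj b (z b)) (hinj : ∀ b < r, ∀ b' < r, z b = z b' → b = b') :
    ∑ b ∈ Finset.range r, w b (z b) ≤ ∑ b ∈ Finset.range r, w b (x b) := by
  have h1 : ∑ b ∈ Finset.range r, π (z b) ≤ ∑ b ∈ Finset.range r, π (x b) := by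
    rw [← Finset.sum_image (f := π) (g := z) (s := Finset.range r)
        (fun b hb b' hb' => hinj b (by simpa using hb) b' (by simpa using hb')),
      ← Finset.sum_image (f := π) (g := x) (s := Finset.range r)
        (fun b hb b' hb' => h.inj b (by simpa using hb) b' (by simpa using hb'))]
    -- Columns used by `z` but not by `x` are unmatched and cost nothing; those used only by `x`
    -- have nonnegative price. Hence `x` pays at least as much as `z`.
    have h2 : ∀ c ∈ (Finset.range r).image z, c ∉ (Finset.range r).image x → π c = 0 := by
      intro c hc hcx
      obtain ⟨b, hb, rfl⟩ := Finset.mem_image.1 hc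
      have hK := (hz b (by simpa using hb)).1
      refine h.zero _ hK (by_contra fun hne => hcx ?_)
      obtain ⟨b', hb', e⟩ := (h.mt_iff _ hK).1 hne
      exact Finset.mem_image.2 ⟨b', by simpa using hb', e⟩
    calc ∑ c ∈ (Finset.range r).image z, π c
        = ∑ c ∈ (Finset.range r).image z ∩ (Finset.range r).image x, π c := by
          refine (Finset.sum_subset Finset.inter_subset_left fun c hc hn => h2 c hc fun hx => ?_).symm
          exact hn (Finset.mem_inter.2 ⟨hc, hx⟩)
      _ ≤ ∑ c ∈ (Finset.range r).image x, π c := by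
          refine Finset.sum_le_sum_of_subset_of_nonneg Finset.inter_subset_right fun c hc _ => ?_
          obtain ⟨b, hb, rfl⟩ := Finset.mem_image.1 hc
          exact h.nonneg _ (h.lt b (by simpa using hb))
  have h2 : ∑ b ∈ Finset.range r, (w b (z b) - π (z b))
      ≤ ∑ b ∈ Finset.range r, (w b (x b) - π (x b)) := by
    refine Finset.sum_le_sum fun b hb => ?_
    have hb := Finset.mem_range.1 hb
    exact h.best b hb _ (hz b hb).1 (hz b hb).2
  rw [Finset.sum_sub_distrib, Finset.sum_sub_distrib] at h2
  linarith

end RowMatching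

/-! ### Straight-line programs and frame conditions -/

namespace RealRAM

/-- Straight-line programs. -/
def Prog.isStraight : Prog → Bool
  | .skip => true
  | .setNat .. => true
  | .setReal .. => true
  | .seq c d => c.isStraight && d.isStraight
  | .ite .. => false
  | .while .. => false

/-- Effect of a straight-line program. -/
noncomputable def Prog.exec : Prog → Mem → Mem
  | .skip, s => s
  | .setNat k i j e, s => s.setNat k (i.eval s) (j.eval s) (e.eval s)
  | .setReal k i j e, s => s.setReal k (i.eval s) (j.eval s) (e.eval s)
  | .seq c d, s => d.exec (c.exec s)
  | .ite .., s => s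
  | .while .., s => s

/-- Running time of a straight-line program. -/
def Prog.time : Prog → ℕ
  | .skip => 1
  | .setNat _ i j e => i.cost + j.cost + e.cost + 1
  | .setReal _ i j e => i.cost + j.cost + e.cost + 1
  | .seq c d => c.time + d.time
  | .ite .. => 0
  | .while .. => 0

theorem Prog.runs_exec : ∀ (c : Prog) (s : Mem), c.isStraight → Runs c s (c.exec s) c.time
  | .skip, s, _ => .skip s
  | .setNat k i j e, s, _ => .setNat k i j e s
  | .setReal k i j e, s, _ => .setReal k i j e s
  | .seq c d, s, h => by
    simp only [isStraight, Bool.and_eq_true] at h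
    exact .seq (runs_exec c s h.1) (runs_exec d _ h.2)

theorem WP.straight {c : Prog} {T : ℕ} {Q : Mem → Prop} {s : Mem} (hc : c.isStraight)
    (hT : c.time ≤ T) (h : Q (c.exec s)) : WP c T Q s :=
  ⟨_, _, c.runs_exec s hc, hT, h⟩

/-- The memories `s` and `s'` agree, except possibly on the arrays of natural numbers in `L` and
on the arrays of real numbers in `R`. -/
def Frame (L R : List ℕ) (s s' : Mem) : Prop :=
  (∀ k ∉ L, s'.nat k = s.nat k) ∧ ∀ k ∉ R, s'.real k = s.real k

section

variable {L L' R R' : List ℕ} {s s' s'' : Mem}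

theorem Frame.refl (L R : List ℕ) (s : Mem) : Frame L R s s :=
  ⟨fun _ _ => rfl, fun _ _ => rfl⟩

theorem Frame.trans (h : Frame L R s s') (h' : Frame L R s' s'') : Frame L R s s'' :=
  ⟨fun k hk => (h'.1 k hk).trans (h.1 k hk), fun k hk => (h'.2 k hk).trans (h.2 k hk)⟩

theorem Frame.mono (h : Frame L R s s') (hL : L ⊆ L') (hR : R ⊆ R') : Frame L' R' s s' :=
  ⟨fun k hk => h.1 k fun h => hk (hL h), fun k hk => h.2 k fun h => hk (hR h)⟩

theorem Frame.setNat (h : Frame L R s s') {k : ℕ} (hk : k ∈ L) (i j v : ℕ) :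
    Frame L R s (s'.setNat k i j v) :=
  ⟨fun k' hk' => by rw [Mem.setNat_nat_of_ne _ _ _ _ _ (by rintro rfl; exact hk' hk), h.1 k' hk'],
    h.2⟩

theorem Frame.setReal (h : Frame L R s s') {k : ℕ} (hk : k ∈ R) (i j : ℕ) (v : ℝ) :
    Frame L R s (s'.setReal k i j v) :=
  ⟨h.1, fun k' hk' => by
    rw [Mem.setReal_real_of_ne _ _ _ _ _ (by rintro rfl; exact hk' hk), h.2 k' hk']⟩

end

end RealRAM

/-! ### Inner loops: least slack, price update, augmentation -/

namespace RowMatching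

open RealRAM

/-!
The matching program keeps the admissibility relation in array `8`, the weights in real array `1`,
`x`, `vis`, `way`, `mt` in arrays `10` to `13`, the prices in real array `2`, the numbers of rows
and columns in variables `20` and `21`, the current row in variable `22`, and the flag that says
that there is no row-perfect matching in variable `30`.
-/

/-- The slack of the current pair. -/
def slackExp : RExp :=
  .sub (.sub (.get 1 (.var 25) (.at 10 (.var 25))) (.get 2 (.const 0) (.at 10 (.var 25))))
    (.sub (.get 1 (.var 25) (.var 26)) (.get 2 (.const 0) (.var 26)))

/-- The current pair is a candidate that is better than the candidates found before. -/
def scanTest : BExp :=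
  .and (.natLT (.const 0) (.at 11 (.at 10 (.var 25)))) (.and (.natLE (.at 11 (.var 26)) (.const 0))
    (.and (.natLT (.const 0) (.get 8 (.var 25) (.var 26)))
      (.or (.natLE (.var 24) (.const 0)) (.realLT slackExp (.get 3 (.const 0) (.const 0))))))

/-- Record the current pair. -/
def scanRecord : Prog :=
  .seq (.setReal 3 (.const 0) (.const 0) slackExp) (.seq (.assign 24 (.const 1))
    (.seq (.assign 27 (.var 25)) (.assign 28 (.var 26))))

/-- Search for a candidate of minimum slack. -/
def scan : Prog :=
  .for 25 (.add (.var 22) (.const 1)) (.for 26 (.var 21) (.ite scanTest scanRecord .skip))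

/-- Result of a search for a candidate among the pairs satisfying `P`; `s` is the memory at the
beginning, `s'` the current memory. -/
def Scanned (s : Mem) (K r : ℕ) (P : ℕ → ℕ → Prop) (s' : Mem) : Prop :=
  (s'.nat 24 0 0 = 0 ∧ ∀ b c, P b c →
    ¬ Candidate (fun b c => s.nat 8 b c ≠ 0) K r (s.nat 10 0) (s.nat 11 0) b c) ∨
  (s'.nat 24 0 0 ≠ 0 ∧
    Candidate (fun b c => s.nat 8 b c ≠ 0) K r (s.nat 10 0) (s.nat 11 0)
      (s'.nat 27 0 0) (s'.nat 28 0 0) ∧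
    s'.real 3 0 0 = slack (s.real 1) (s.nat 10 0) (s.real 2 0) (s'.nat 27 0 0) (s'.nat 28 0 0) ∧
    ∀ b c, P b c → Candidate (fun b c => s.nat 8 b c ≠ 0) K r (s.nat 10 0) (s.nat 11 0) b c →
      s'.real 3 0 0 ≤ slack (s.real 1) (s.nat 10 0) (s.real 2 0) b c)

/-- The scanned region has to be compared on candidates only. These have `b ≤ r` and `c < K`, which
is what closes each of the two loops. -/
theorem Scanned.of_eq {s s₁ s₂ : Mem} {K r : ℕ} {P P' : ℕ → ℕ → Prop} (h : Scanned s K r P s₁)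
    (h24 : s₂.nat 24 = s₁.nat 24) (h27 : s₂.nat 27 = s₁.nat 27) (h28 : s₂.nat 28 = s₁.nat 28)
    (h3 : s₂.real 3 = s₁.real 3)
    (hP : ∀ b c, P' b c →
      Candidate (fun b c => s.nat 8 b c ≠ 0) K r (s.nat 10 0) (s.nat 11 0) b c → P b c) :
    Scanned s K r P' s₂ := by
  unfold Scanned
  rw [h24, h27, h28, h3]
  rcases h with ⟨h0, h⟩ | ⟨h0, h1, h2, h⟩
  · exact .inl ⟨h0, fun b c hb hc => h b c (hP b c hb hc) hc⟩
  · exact .inr ⟨h0, h1, h2, fun b c hb hc => h b c (hP b c hb hc) hc⟩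

theorem scan_body (s s' : Mem) {K r b c : ℕ} (hb : b ≤ r) (hc : c < K) (P : ℕ → ℕ → Prop)
    (hF : Frame [24, 25, 26, 27, 28] [3] s s') (h25 : s'.nat 25 0 0 = b) (h26 : s'.nat 26 0 0 = c)
    (h : Scanned s K r P s') :
    WP (.ite scanTest scanRecord .skip) 400
      (fun s'' => Frame [24, 25, 26, 27, 28] [3] s s'' ∧ s''.nat 25 0 0 = b ∧ s''.nat 26 0 0 = c ∧
        Scanned s K r (fun b' c' => P b' c' ∨ b' = b ∧ c' = c) s'') s' := by
  have e8 : s'.nat 8 = s.nat 8 := hF.1 8 (by simp)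
  have e10 : s'.nat 10 = s.nat 10 := hF.1 10 (by simp)
  have e11 : s'.nat 11 = s.nat 11 := hF.1 11 (by simp)
  have e1 : s'.real 1 = s.real 1 := hF.2 1 (by simp)
  have e2 : s'.real 2 = s.real 2 := hF.2 2 (by simp)
  have hs : slackExp.eval s' = slack (s.real 1) (s.nat 10 0) (s.real 2 0) b c := by
    simp [slackExp, slack, RExp.eval, NExp.eval, e10, e1, e2, h25, h26]
  -- While no candidate is recorded, the content of real variable `3` is ignored, so no infinite
  -- initial value is needed.
  have htest : scanTest.Holds s' ↔
      Candidate (fun b c => s.nat 8 b c ≠ 0) K r (s.nat 10 0) (s.nat 11 0) b c ∧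
        (s'.nat 24 0 0 ≠ 0 →
          slack (s.real 1) (s.nat 10 0) (s.real 2 0) b c < s'.real 3 0 0) := by
    simp only [scanTest, BExp.Holds, NExp.eval, e8, e10, e11, h25, h26, hs, Candidate, hb, hc,
      RExp.eval, true_and, Nat.le_zero, not_le, not_and, not_not]
    tauto
  refine (WP.ite (T := 150) (fun ht => ?_) (fun ht => ?_)).mono (by decide) fun _ h => h
  · rw [htest] at ht
    refine WP.straight rfl (by decide) ?_
    refine ⟨?_, ?_, ?_, ?_⟩
    · exact (((hF.setReal (by simp) _ _ _).setNat (by simp) _ _ _).setNat (by simp) _ _ _).setNat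
        (by simp) _ _ _
    · simp [scanRecord, Prog.exec, h25]
    · simp [scanRecord, Prog.exec, h26]
    · refine .inr ⟨?_, ?_, ?_, ?_⟩
      · simp [scanRecord, Prog.exec, NExp.eval]
      · simpa [scanRecord, Prog.exec, NExp.eval, h25, h26] using ht.1
      · simp [scanRecord, Prog.exec, NExp.eval, h25, h26, hs]
      · intro b' c' hP hcand
        have : (scanRecord.exec s').real 3 0 0 = slack (s.real 1) (s.nat 10 0) (s.real 2 0) b c := by
          simp [scanRecord, Prog.exec, NExp.eval, hs]
        rw [this]
        rcases hP with hP | ⟨rfl, rfl⟩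
        · rcases h with ⟨h0, h⟩ | ⟨h0, -, -, h⟩
          · exact absurd hcand (h b' c' hP)
          · exact (ht.2 h0).le.trans (h b' c' hP hcand)
        · exact le_rfl
  · rw [htest] at ht
    refine WP.skip ⟨hF, h25, h26, ?_⟩ (by decide)
    rcases h with ⟨h0, h⟩ | ⟨h0, h1, h2, h⟩
    · refine .inl ⟨h0, ?_⟩
      rintro b' c' (hP | ⟨rfl, rfl⟩)
      · exact h b' c' hP
      · exact fun hcand => ht ⟨hcand, fun h => absurd h0 h⟩
    · refine .inr ⟨h0, h1, h2, ?_⟩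
      rintro b' c' (hP | ⟨rfl, rfl⟩) hcand
      · exact h b' c' hP hcand
      · exact not_lt.1 fun hlt => ht ⟨hcand, fun _ => hlt⟩

theorem scan_spec (s : Mem) {K r D : ℕ} (h21 : s.nat 21 0 0 = K) (h22 : s.nat 22 0 0 = r)
    (hr : r < D) (hK : K ≤ D) (h24 : s.nat 24 0 0 = 0) :
    WP scan ((D + 2) * ((D + 2) * 450 + 50))
      (fun s' => Frame [24, 25, 26, 27, 28] [3] s s' ∧ Scanned s K r (fun _ _ => True) s') s := by
  refine WP.for (B := r + 1) (T := (D + 2) * 450)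
    (fun b s' => Frame [24, 25, 26, 27, 28] [3] s s' ∧ Scanned s K r (fun b' _ => b' < b) s')
    ?_ ?_ ?_ ?_ ?_
  · exact ⟨(Frame.refl _ _ _).setNat (by simp) _ _ _, .inl ⟨by simpa using h24, by simp⟩⟩
  · rintro b s' ⟨hF, -⟩
    have : s'.nat 22 = s.nat 22 := hF.1 22 (by simp)
    simp [NExp.eval, this, h22]
  · rintro b hb s₁ ⟨hF, hS⟩ h25
    refine WP.for (B := K) (T := 400)
      (fun c s' => Frame [24, 25, 26, 27, 28] [3] s s' ∧ s'.nat 25 0 0 = b ∧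
        Scanned s K r (fun b' c' => b' < b ∨ b' = b ∧ c' < c) s') ?_ ?_ ?_ ?_ ?_
    · exact ⟨hF.setNat (by simp) _ _ _, by simpa using h25,
        hS.of_eq (by simp) (by simp) (by simp) rfl fun b' c' h _ => by simpa using h⟩
    · rintro c s' ⟨hF, -⟩
      have : s'.nat 21 = s.nat 21 := hF.1 21 (by simp)
      simp [NExp.eval, this, h21]
    · rintro c hc s₂ ⟨hF, h25, hS⟩ h26
      refine (scan_body s s₂ (by omega) hc _ hF h25 h26 hS).mono le_rfl ?_
      rintro s₃ ⟨hF, h25, h26, hS⟩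
      refine ⟨h26, hF.setNat (by simp) _ _ _, by simpa using h25,
        hS.of_eq (by simp) (by simp) (by simp) rfl ?_⟩
      intro b' c' h _
      omega
    · rintro s₂ - ⟨hF, h25, hS⟩
      refine ⟨h25, hF.setNat (by simp) _ _ _, hS.of_eq (by simp) (by simp) (by simp) rfl ?_⟩
      rintro b' c' h ⟨-, hc', -⟩
      omega
    · simp only [NExp.cost]
      exact Nat.mul_le_mul (by omega) (by omega)
  · rintro s' - ⟨hF, hS⟩
    refine ⟨hF, hS.of_eq rfl rfl rfl rfl ?_⟩
    rintro b c - ⟨hb, -⟩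
    omega
  · simp only [NExp.cost]
    exact Nat.mul_le_mul (by omega) (by omega)

/-- Add the recorded slack to the prices of the visited columns. -/
def updatePrices : Prog :=
  .for 26 (.add (.var 21) (.const 1)) (.ite (.natLT (.const 0) (.at 11 (.var 26)))
    (.setReal 2 (.const 0) (.var 26)
      (.add (.get 2 (.const 0) (.var 26)) (.get 3 (.const 0) (.const 0)))) .skip)

theorem updatePrices_spec (s : Mem) {K D : ℕ} (h21 : s.nat 21 0 0 = K) (hK : K ≤ D) :
    WP updatePrices ((D + 3) * 100)
      (fun s' => Frame [26] [2] s s' ∧ ∀ c ≤ K, s'.real 2 0 c =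
        if s.nat 11 0 c ≠ 0 then s.real 2 0 c + s.real 3 0 0 else s.real 2 0 c) s := by
  -- The range includes the virtual column `K`, whose price must also move.
  refine WP.for (B := K + 1) (T := 50)
    (fun j s' => Frame [26] [2] s s' ∧ ∀ c, s'.real 2 0 c =
      if c < j ∧ s.nat 11 0 c ≠ 0 then s.real 2 0 c + s.real 3 0 0 else s.real 2 0 c)
    ?_ ?_ ?_ ?_ ?_
  · exact ⟨(Frame.refl _ _ _).setNat (by simp) _ _ _, by simp⟩
  · rintro b s' ⟨hF, -⟩
    have : s'.nat 21 = s.nat 21 := hF.1 21 (by simp)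
    simp [NExp.eval, this, h21]
  · rintro j hj s' ⟨hF, hS⟩ h26
    have e11 : s'.nat 11 = s.nat 11 := hF.1 11 (by simp)
    have e3 : s'.real 3 = s.real 3 := hF.2 3 (by simp)
    refine (WP.ite (T := 30) (fun ht => ?_) (fun ht => ?_)).mono (by decide) fun _ h => h
    · simp only [BExp.Holds, NExp.eval, h26, e11, Nat.le_zero] at ht
      refine WP.setReal ⟨h26, (hF.setReal (by simp) _ _ _).setNat (by simp) _ _ _, ?_⟩ (by decide)
      intro c
      by_cases hc : c = j
      · subst hc
        simp [NExp.eval, RExp.eval, h26, hS, e3, ht]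
      · have : c < j + 1 ↔ c < j := by omega
        simp [NExp.eval, h26, hS, hc, this]
    · simp only [BExp.Holds, NExp.eval, h26, e11, Nat.le_zero, not_not] at ht
      refine WP.skip ⟨h26, hF.setNat (by simp) _ _ _, ?_⟩ (by decide)
      intro c
      by_cases hc : c = j
      · subst hc
        simp [hS, ht]
      · have : c < j + 1 ↔ c < j := by omega
        simp [hS, this]
  · rintro s' - ⟨hF, hS⟩
    refine ⟨hF, fun c hc => ?_⟩
    have : c < K + 1 := by omega
    simp [hS, this]
  · simp only [NExp.cost]
    exact Nat.mul_le_mul (by omega) (by omega)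

/-- One step of the augmentation. -/
def augmentBody : Prog :=
  .seq (.assign 25 (.at 12 (.var 35))) (.seq (.assign 34 (.at 10 (.var 25)))
    (.seq (.assignAt 10 (.var 25) (.var 35)) (.assign 35 (.var 34))))

/-- Augment along the search tree, beginning at the column in variable `35`. -/
def augmentPath : Prog :=
  .while (.natLT (.var 35) (.var 21)) augmentBody

/-- The visiting time of the free column is the variant; it strictly decreases until the root `K` is
reached. -/
theorem augmentPath_spec (s : Mem) {adj : ℕ → ℕ → Prop} {w : ℕ → ℕ → ℝ} {π : ℕ → ℝ}
    {mt : ℕ → ℕ} {K r c₁ k D : ℕ}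
    (h21 : s.nat 21 0 0 = K) (h35 : s.nat 35 0 0 = c₁) (hv : s.nat 11 0 c₁ ≤ k) (hk : k ≤ D)
    (h : Augment adj w K r mt (s.nat 11 0) (s.nat 12 0) π c₁ (s.nat 10 0) c₁) :
    WP augmentPath ((D + 1) * 100)
      (fun s' => Frame [10, 25, 34, 35] [] s s' ∧
        Augment adj w K r mt (s.nat 11 0) (s.nat 12 0) π c₁ (s'.nat 10 0) K) s := by
  refine (WP.while (T := 50) (fun j s' => Frame [10, 25, 34, 35] [] s s' ∧
    s.nat 11 0 (s'.nat 35 0 0) = j ∧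
    (s'.nat 35 0 0 < K → mt (s'.nat 35 0 0) ≠ 0 ∨ s'.nat 35 0 0 = c₁) ∧
    Augment adj w K r mt (s.nat 11 0) (s.nat 12 0) π c₁ (s'.nat 10 0) (s'.nat 35 0 0)) ?_
    (s.nat 11 0 c₁) s ⟨Frame.refl _ _ _, by rw [h35], fun _ => .inr h35, by rwa [h35]⟩).mono ?_ ?_
  · rintro j s' ⟨hF, hj, hm, hA⟩ hb
    have e21 : s'.nat 21 = s.nat 21 := hF.1 21 (by simp)
    have e12 : s'.nat 12 = s.nat 12 := hF.1 12 (by simp)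
    simp only [BExp.Holds, NExp.eval, e21, h21, not_le] at hb
    obtain ⟨hA', hlt, hm'⟩ := hA.step (hm hb) hb
    have h35 : (augmentBody.exec s').nat 35 0 0
        = s'.nat 10 0 (s.nat 12 0 (s'.nat 35 0 0)) := by
      simp [augmentBody, Prog.exec, NExp.eval, e12]
    have h10 : (augmentBody.exec s').nat 10 0
        = Function.update (s'.nat 10 0) (s.nat 12 0 (s'.nat 35 0 0)) (s'.nat 35 0 0) := by
      simp [augmentBody, Prog.exec, NExp.eval, e12]
    refine WP.straight rfl (by decide) ⟨_, ?_, ?_, rfl, ?_, ?_⟩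
    · rw [h35, ← hj]; exact hlt
    · exact (((hF.setNat (by simp) _ _ _).setNat (by simp) _ _ _).setNat (by simp) _ _ _).setNat
        (by simp) _ _ _
    · rw [h35]; exact hm'
    · rw [h35, h10]; exact hA'
  · refine Nat.mul_le_mul (by omega) (by decide)
  · rintro s' ⟨⟨j, hF, -, -, hA⟩, hb⟩
    have e21 : s'.nat 21 = s.nat 21 := hF.1 21 (by simp)
    simp only [BExp.Holds, NExp.eval, e21, h21, not_not] at hb
    have : s'.nat 35 0 0 = K := le_antisymm hA.le hb
    rw [this] at hA
    exact ⟨hF, hA⟩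

end RowMatching

/-! ### Inserting the rows -/

namespace RowMatching

open RealRAM

/-- Arrays of natural numbers that the matching program changes. -/
abbrev workNat : List ℕ := [10, 11, 12, 13, 22, 23, 24, 25, 26, 27, 28, 29, 30, 34, 35]

/-- Arrays of real numbers that the matching program changes. -/
abbrev workReal : List ℕ := [2, 3]

/-- Between two insertions: the rows `b < r` are matched optimally. -/
structure RowInv (s : Mem) (K r : ℕ) (s' : Mem) : Prop where
  frame : Frame workNat workReal s s'
  row : s'.nat 22 0 0 = r
  fail : s'.nat 30 0 0 = 0
  matched : Matched (fun b c => s.nat 8 b c ≠ 0) (s.real 1) K r (s'.nat 10 0) (s'.nat 13 0)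
    (s'.real 2 0)

/-- After an unsuccessful insertion: there is no row-perfect matching. -/
structure FailInv (s : Mem) (K r : ℕ) (s' : Mem) : Prop where
  frame : Frame workNat workReal s s'
  row : s'.nat 22 0 0 = r
  fail : s'.nat 30 0 0 ≠ 0
  not_exists : ∀ z : ℕ → ℕ, (∀ b ≤ r, z b < K ∧ s.nat 8 b (z b) ≠ 0) →
    ¬ ∀ b ≤ r, ∀ b' ≤ r, z b = z b' → b = b'

/-- During the insertion of row `r`, after `k` columns were visited. -/
structure SearchInv (s : Mem) (K r k : ℕ) (s' : Mem) : Prop where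
  frame : Frame workNat workReal s s'
  row : s'.nat 22 0 0 = r
  fail : s'.nat 30 0 0 = 0
  running : s'.nat 23 0 0 = 0
  time : s'.nat 29 0 0 = k + 1
  search : Search (fun b c => s.nat 8 b c ≠ 0) (s.real 1) K r (s'.nat 10 0) (s'.nat 13 0)
    (s'.nat 11 0) (s'.nat 12 0) (s'.real 2 0) k
  mt : ∀ c < K, s'.nat 11 0 c ≠ 0 → s'.nat 13 0 c ≠ 0

/-- Begin the insertion of the current row. -/
def initSearch : Prog :=
  .seq (.assignAt 10 (.var 22) (.var 21))
    (.seq (.for 26 (.var 21) (.assignAt 11 (.var 26) (.const 0)))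
      (.seq (.assignAt 11 (.var 21) (.const 1)) (.seq (.assign 29 (.const 1))
        (.assign 23 (.const 0)))))

theorem initSearch_spec (s s' : Mem) {K r D : ℕ} (h21 : s.nat 21 0 0 = K) (hK : K ≤ D)
    (h : RowInv s K r s') : WP initSearch ((D + 3) * 100) (SearchInv s K r 0) s' := by
  have e21 : s'.nat 21 = s.nat 21 := h.frame.1 21 (by simp)
  have key : WP (.for 26 (.var 21) (.assignAt 11 (.var 26) (.const 0))) ((D + 2) * 50)
      (fun s₂ => Frame [11, 26] [] (s'.setNat 10 0 r K) s₂ ∧ ∀ c < K, s₂.nat 11 0 c = 0)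
      (s'.setNat 10 0 r K) := by
    refine WP.for (B := K) (T := 10) (fun j s₂ => Frame [11, 26] [] (s'.setNat 10 0 r K) s₂ ∧
      ∀ c < j, s₂.nat 11 0 c = 0) ?_ ?_ ?_ ?_ ?_
    · exact ⟨(Frame.refl _ _ _).setNat (by simp) _ _ _, by simp⟩
    · rintro j s₂ ⟨hF, -⟩
      have : s₂.nat 21 = s'.nat 21 := by simpa using hF.1 21 (by simp)
      simp [NExp.eval, this, e21, h21]
    · rintro j hj s₂ ⟨hF, h0⟩ h26
      refine WP.setNat ⟨by simpa using h26,
        (hF.setNat (by simp) _ _ _).setNat (by simp) _ _ _, ?_⟩ (by decide)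
      intro c hc
      by_cases hcj : c = j
      · subst hcj; simp [NExp.eval, h26]
      · simp [NExp.eval, h26, hcj, h0 c (by omega)]
    · rintro s₂ - h
      exact h
    · simp only [NExp.cost]
      exact Nat.mul_le_mul (by omega) (by omega)
  have heval : NExp.eval s' (.const 0) = 0 ∧ NExp.eval s' (.var 22) = r ∧
      NExp.eval s' (.var 21) = K := by simp [NExp.eval, h.row, e21, h21]
  refine (WP.seq (T := 10) (T' := (D + 2) * 50 + 50)
    (WP.setNat ?_ (by decide))).mono (by omega) fun _ h => h
  rw [heval.1, heval.2.1, heval.2.2]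
  refine WP.seq (key.mono le_rfl fun s₂ h₂ => WP.straight rfl (by decide) ?_)
  obtain ⟨hF, h0⟩ := h₂
  have f21 : s₂.nat 21 = s'.nat 21 := by simpa using hF.1 21 (by simp)
  have f22 : s₂.nat 22 = s'.nat 22 := by simpa using hF.1 22 (by simp)
  have f30 : s₂.nat 30 = s'.nat 30 := by simpa using hF.1 30 (by simp)
  have f13 : s₂.nat 13 = s'.nat 13 := by simpa using hF.1 13 (by simp)
  have f10 : s₂.nat 10 0 = Function.update (s'.nat 10 0) r K := by
    rw [hF.1 10 (by simp), Mem.setNat_nat_row]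
  have f2 : s₂.real 2 = s'.real 2 := by simpa using hF.2 2 (by simp)
  have hfr := (h.frame.setNat (k := 10) (by simp) 0 r K).trans (hF.mono (by simp) (by simp))
  refine ⟨((hfr.setNat (by simp) _ _ _).setNat (by simp) _ _ _).setNat (by simp) _ _ _,
    ?_, ?_, ?_, ?_, ?_, ?_⟩
  · simp [Prog.exec, f22, h.row]
  · simp [Prog.exec, f30, h.fail]
  · simp [Prog.exec, NExp.eval]
  · simp [Prog.exec, NExp.eval]
  · have hvis : ∀ c < K, Function.update (s₂.nat 11 0) K 1 c = 0 := fun c hc => by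
      rw [Function.update_of_ne hc.ne, h0 c hc]
    simp only [Prog.exec, NExp.eval, Mem.setNat_real, f2, f21, e21, h21]
    simp only [ne_eq, Nat.reduceEqDiff, not_false_eq_true,
      Mem.setNat_nat_of_ne, Mem.setNat_nat_row, f10, f13]
    refine Search.start h.matched _ hvis (by simp) _ (fun _ _ => rfl) _ ?_ (by simp)
    intro b hb
    rw [Function.update_of_ne hb.ne]
  · intro c hc hv
    refine absurd ?_ hv
    simp [Prog.exec, NExp.eval, f21, e21, h21, hc.ne, h0 c hc]

/-- Visit the column of the candidate. -/
def visit : Prog :=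
  .seq (.assign 29 (.add (.var 29) (.const 1)))
    (.seq (.assignAt 11 (.var 28) (.var 29)) (.assignAt 12 (.var 28) (.var 27)))

/-- If the column of the candidate is free, augment. -/
def tryAugment : Prog :=
  .ite (.natLE (.at 13 (.var 28)) (.const 0))
    (.seq (.seq (.assignAt 13 (.var 28) (.const 1)) (.assign 35 (.var 28)))
      (.seq augmentPath
        (.seq (.assign 22 (.add (.var 22) (.const 1))) (.assign 23 (.const 1))))) .skip

/-- One step of the search for an augmenting path. -/
def searchStep : Prog :=
  .seq (.assign 24 (.const 0)) (.seq scan (.ite (.natLE (.var 24) (.const 0))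
    (.seq (.assign 30 (.const 1)) (.assign 23 (.const 1)))
    (.seq updatePrices (.seq visit tryAugment))))

/-- What holds after one step of the search. -/
def StepPost (s : Mem) (K r k : ℕ) (s' : Mem) : Prop :=
  SearchInv s K r (k + 1) s' ∨
    s'.nat 23 0 0 ≠ 0 ∧ (RowInv s K (r + 1) s' ∨ FailInv s K r s')

/-- Only the newly visited column `c₀` can be unmatched: either it ends the search, or all visited
columns are matched and the search goes on. -/
theorem tryAugment_spec (s s' : Mem) {K r k c₀ D : ℕ} (h21 : s.nat 21 0 0 = K) (hK : K ≤ D)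
    (hF : Frame workNat workReal s s') (h22 : s'.nat 22 0 0 = r) (h30 : s'.nat 30 0 0 = 0)
    (h23 : s'.nat 23 0 0 = 0) (h29 : s'.nat 29 0 0 = k + 2)
    (hS : Search (fun b c => s.nat 8 b c ≠ 0) (s.real 1) K r (s'.nat 10 0) (s'.nat 13 0)
      (s'.nat 11 0) (s'.nat 12 0) (s'.real 2 0) (k + 1)) (h28 : s'.nat 28 0 0 = c₀) (hc₀ : c₀ < K)
    (hv : s'.nat 11 0 c₀ ≠ 0)
    (hmt : ∀ c < K, c ≠ c₀ → s'.nat 11 0 c ≠ 0 → s'.nat 13 0 c ≠ 0) :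
    WP tryAugment ((D + 3) * 100) (StepPost s K r k) s' := by
  have e21 : s'.nat 21 = s.nat 21 := hF.1 21 (by simp)
  refine (WP.ite (T := (D + 2) * 100 + 50) (fun ht => ?_) (fun ht => ?_)).mono ?_ fun _ h => h
  · simp only [BExp.Holds, NExp.eval, h28, Nat.le_zero] at ht
    refine (WP.seq (T := 20) (T' := (D + 2) * 100 + 20)
      (WP.straight rfl (by decide) ?_)).mono (by omega) fun _ h => h
    set s₁ := Prog.exec (.seq (.assignAt 13 (.var 28) (.const 1)) (.assign 35 (.var 28))) s'
      with hs₁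
    have g11 : s₁.nat 11 = s'.nat 11 := by simp [hs₁, Prog.exec]
    have g12 : s₁.nat 12 = s'.nat 12 := by simp [hs₁, Prog.exec]
    have g10 : s₁.nat 10 = s'.nat 10 := by simp [hs₁, Prog.exec]
    have g21 : s₁.nat 21 = s'.nat 21 := by simp [hs₁, Prog.exec]
    have g22 : s₁.nat 22 = s'.nat 22 := by simp [hs₁, Prog.exec]
    have g30 : s₁.nat 30 = s'.nat 30 := by simp [hs₁, Prog.exec]
    have g2 : s₁.real 2 = s'.real 2 := by simp [hs₁, Prog.exec]
    have g35 : s₁.nat 35 0 0 = c₀ := by simp [hs₁, Prog.exec, NExp.eval, h28]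
    have g13 : s₁.nat 13 0 = Function.update (s'.nat 13 0) c₀ 1 := by
      simp [hs₁, Prog.exec, NExp.eval, h28]
    have hF₁ : Frame workNat workReal s s₁ :=
      (hF.setNat (by simp) _ _ _).setNat (by simp) _ _ _
    have hA := hS.augment (by omega) hc₀ hv ht
    have hkK := hS.le_card
    -- The root has time `1`, so visiting times can reach `K + 1`; hence the bound `D + 1`.
    refine (WP.seq (T := (D + 1 + 1) * 100) (T' := 20)
      ((augmentPath_spec s₁ (mt := s'.nat 13 0) (π := s'.real 2 0) (K := K) (r := r) (c₁ := c₀)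
        (k := k + 2) (D := D + 1) (adj := fun b c => s.nat 8 b c ≠ 0) (w := s.real 1)
        (by rw [g21, e21, h21]) g35 (by rw [g11]; exact hS.vis_le c₀ hc₀) (by omega)
        (by rw [g11, g12, g10]; exact hA)).mono le_rfl ?_)).mono (by omega) fun _ h => h
    rintro s₂ ⟨hF₂, hA₂⟩
    refine WP.straight rfl (by decide) (.inr ⟨by simp [Prog.exec, NExp.eval], .inl ?_⟩)
    have k13 : s₂.nat 13 = s₁.nat 13 := hF₂.1 13 (by simp)
    have k22 : s₂.nat 22 = s₁.nat 22 := hF₂.1 22 (by simp)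
    have k30 : s₂.nat 30 = s₁.nat 30 := hF₂.1 30 (by simp)
    have k2 : s₂.real 2 = s₁.real 2 := hF₂.2 2 (by simp)
    refine ⟨((hF₁.trans (hF₂.mono (by simp) (by simp))).setNat (by simp) _ _ _).setNat (by simp)
      _ _ _, ?_, ?_, ?_⟩
    · simp [Prog.exec, NExp.eval, k22, g22, h22]
    · simp [Prog.exec, k30, g30, h30]
    · have := hA₂.matched hc₀ hS.matched.nonneg hS.matched.zero
      simpa [Prog.exec, k13, k2, g13, g2] using this
  · simp only [BExp.Holds, NExp.eval, h28, Nat.le_zero] at ht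
    refine WP.skip (.inl ⟨hF, h22, h30, h23, h29, hS, ?_⟩) (by omega)
    intro c hc hv
    by_cases hcc : c = c₀
    · rwa [hcc]
    · exact hmt c hc hcc hv
  · simp only [BExp.cost, NExp.cost]
    omega

theorem searchStep_spec (s s' : Mem) {K r k D : ℕ} (h21 : s.nat 21 0 0 = K) (hK : K ≤ D)
    (hr : r < D) (h : SearchInv s K r k s') :
    WP searchStep ((D + 4) * ((D + 4) * 1000)) (StepPost s K r k) s' := by
  have e21 : s'.nat 21 = s.nat 21 := h.frame.1 21 (by simp)
  have e8 : s'.nat 8 = s.nat 8 := h.frame.1 8 (by simp)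
  have e1 : s'.real 1 = s.real 1 := h.frame.2 1 (by simp)
  refine (WP.seq (T := 10) (T' := (D + 2) * ((D + 2) * 450 + 50) + ((D + 4) * 300))
    (WP.setNat ?_ (by decide))).mono (by nlinarith) fun _ h => h
  set s₁ := s'.setNat 24 (NExp.eval s' (.const 0)) (NExp.eval s' (.const 0))
    (NExp.eval s' (.const 0)) with hs₁
  refine WP.seq ((scan_spec s₁ (K := K) (r := r) (D := D) (by simp [hs₁, e21, h21])
    (by simp [hs₁, h.row]) hr hK (by simp [hs₁, NExp.eval])).mono le_rfl ?_)
  rintro s₂ ⟨hF₂, hS₂⟩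
  have hF : Frame workNat workReal s s₂ :=
    (h.frame.setNat (k := 24) (by simp) _ _ _).trans (hF₂.mono (by simp) (by simp))
  have f8 : s₁.nat 8 = s.nat 8 := by simp [hs₁, e8]
  have f1 : s₁.real 1 = s.real 1 := by simp [hs₁, e1]
  have f10 : s₁.nat 10 = s'.nat 10 := by simp [hs₁]
  have f11 : s₁.nat 11 = s'.nat 11 := by simp [hs₁]
  have f12 : s₁.nat 12 = s'.nat 12 := by simp [hs₁]
  have f2 : s₁.real 2 = s'.real 2 := by simp [hs₁]
  have g10 : s₂.nat 10 = s'.nat 10 := by rw [hF₂.1 10 (by simp), f10]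
  have g11 : s₂.nat 11 = s'.nat 11 := by rw [hF₂.1 11 (by simp), f11]
  have g12 : s₂.nat 12 = s'.nat 12 := by rw [hF₂.1 12 (by simp), f12]
  have g2 : s₂.real 2 = s'.real 2 := by rw [hF₂.2 2 (by simp), f2]
  have g13 : s₂.nat 13 = s'.nat 13 := by rw [hF₂.1 13 (by simp)]; simp [hs₁]
  have g22 : s₂.nat 22 = s'.nat 22 := by rw [hF₂.1 22 (by simp)]; simp [hs₁]
  have g23 : s₂.nat 23 = s'.nat 23 := by rw [hF₂.1 23 (by simp)]; simp [hs₁]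
  have g29 : s₂.nat 29 = s'.nat 29 := by rw [hF₂.1 29 (by simp)]; simp [hs₁]
  have g30 : s₂.nat 30 = s'.nat 30 := by rw [hF₂.1 30 (by simp)]; simp [hs₁]
  have g21 : s₂.nat 21 = s.nat 21 := hF.1 21 (by simp)
  unfold Scanned at hS₂
  rw [f8, f1, f10, f11, f2] at hS₂
  refine (WP.ite (T := (D + 3) * 200 + 50) (fun ht => ?_) (fun ht => ?_)).mono ?_ fun _ h => h
  · simp only [BExp.Holds, NExp.eval, Nat.le_zero] at ht
    rcases hS₂ with ⟨-, hno⟩ | ⟨h0, -⟩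
    · refine WP.straight rfl (le_trans (b := 20) (by decide) (by omega))
        (.inr ⟨by simp [Prog.exec, NExp.eval], .inr ⟨?_, ?_, ?_, ?_⟩⟩)
      · exact (hF.setNat (by simp) _ _ _).setNat (by simp) _ _ _
      · simp [Prog.exec, g22, h.row]
      · simp [Prog.exec, NExp.eval]
      · exact h.search.not_exists h.mt fun b c => hno b c trivial
    · exact absurd ht h0
  · simp only [BExp.Holds, NExp.eval, Nat.le_zero] at ht
    rcases hS₂ with ⟨h0, -⟩ | ⟨-, hcand, h3, hmin⟩
    · exact absurd h0 ht
    refine (WP.seq (T := (D + 3) * 100) (T' := 50 + (D + 3) * 100)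
      ((updatePrices_spec s₂ (K := K) (by rw [g21, h21]) hK).mono le_rfl ?_)).mono (by omega)
        fun _ h => h
    rintro s₃ ⟨hF₃, hπ⟩
    refine WP.seq (WP.straight rfl (by decide) ?_)
    have k10 : s₃.nat 10 = s'.nat 10 := by rw [hF₃.1 10 (by simp), g10]
    have k11 : s₃.nat 11 = s'.nat 11 := by rw [hF₃.1 11 (by simp), g11]
    have k12 : s₃.nat 12 = s'.nat 12 := by rw [hF₃.1 12 (by simp), g12]
    have k13 : s₃.nat 13 = s'.nat 13 := by rw [hF₃.1 13 (by simp), g13]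
    have k22 : s₃.nat 22 = s'.nat 22 := by rw [hF₃.1 22 (by simp), g22]
    have k23 : s₃.nat 23 = s'.nat 23 := by rw [hF₃.1 23 (by simp), g23]
    have k29 : s₃.nat 29 = s'.nat 29 := by rw [hF₃.1 29 (by simp), g29]
    have k30 : s₃.nat 30 = s'.nat 30 := by rw [hF₃.1 30 (by simp), g30]
    have k27 : s₃.nat 27 = s₂.nat 27 := hF₃.1 27 (by simp)
    have k28 : s₃.nat 28 = s₂.nat 28 := hF₃.1 28 (by simp)
    have hF' : Frame workNat workReal s s₃ := hF.trans (hF₃.mono (by simp) (by simp))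
    rw [g11, g2, h3] at hπ
    have hstep := h.search.step h.mt hcand (fun b c hc => h3 ▸ hmin b c trivial hc) hπ
    set c₀ := s₂.nat 28 0 0
    have m11 : (visit.exec s₃).nat 11 0 = Function.update (s'.nat 11 0) c₀ (k + 2) := by
      simp [visit, Prog.exec, NExp.eval, k11, k28, k29, h.time, c₀]
    have m12 : (visit.exec s₃).nat 12 0 = Function.update (s'.nat 12 0) c₀ (s₂.nat 27 0 0) := by
      simp [visit, Prog.exec, NExp.eval, k12, k28, k27, c₀]
    have m10 : (visit.exec s₃).nat 10 = s'.nat 10 := by simp [visit, Prog.exec, k10]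
    have m13 : (visit.exec s₃).nat 13 = s'.nat 13 := by simp [visit, Prog.exec, k13]
    have m2 : (visit.exec s₃).real 2 = s₃.real 2 := by simp [visit, Prog.exec]
    refine tryAugment_spec s _ (c₀ := c₀) h21 hK ?_ ?_ ?_ ?_ ?_ ?_ ?_ hcand.2.1 ?_ ?_
    · exact ((hF'.setNat (by simp) _ _ _).setNat (by simp) _ _ _).setNat (by simp) _ _ _
    · simp [visit, Prog.exec, k22, h.row]
    · simp [visit, Prog.exec, k30, h.fail]
    · simp [visit, Prog.exec, k23, h.running]
    · simp [visit, Prog.exec, NExp.eval, k29, h.time]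
    · rw [m10, m11, m12, m13, m2]
      exact hstep
    · simp [visit, Prog.exec, k28, c₀]
    · rw [m11]; simp
    · intro c hc hne hv
      rw [m11, Function.update_of_ne hne] at hv
      rw [m13]
      exact h.mt c hc hv
  · simp only [BExp.cost, NExp.cost]
    omega

/-- Insert the current row. -/
def insertRow : Prog :=
  .seq initSearch (.while (.natLE (.var 23) (.const 0)) searchStep)

theorem insertRow_spec (s s' : Mem) {K r D : ℕ} (h21 : s.nat 21 0 0 = K) (hK : K ≤ D)
    (hr : r < D) (h : RowInv s K r s') :
    WP insertRow ((D + 4) * ((D + 4) * ((D + 4) * 2000)))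
      (fun s' => RowInv s K (r + 1) s' ∨ FailInv s K r s') s' := by
  refine (WP.seq (T' := (D + 2) * (5 + 1 + (D + 4) * ((D + 4) * 1000)))
    ((initSearch_spec s s' h21 hK h).mono le_rfl fun s₁ h₁ => ?_)).mono ?_ fun _ h => h
  · refine (WP.while (T := (D + 4) * ((D + 4) * 1000)) (fun j s₂ =>
      (∃ k, j + k = K + 1 ∧ SearchInv s K r k s₂) ∨
      j = 0 ∧ s₂.nat 23 0 0 ≠ 0 ∧ (RowInv s K (r + 1) s₂ ∨ FailInv s K r s₂)) ?_
      (K + 1) s₁ (.inl ⟨0, rfl, h₁⟩)).mono ?_ ?_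
    · rintro j s₂ (⟨k, hj, hI⟩ | ⟨-, h23, -⟩) ht
      · refine (searchStep_spec s s₂ h21 hK hr hI).mono le_rfl ?_
        have hkK := hI.search.le_card
        rintro s₃ (h₃ | h₃)
        · exact ⟨j - 1, by omega, .inl ⟨k + 1, by omega, h₃⟩⟩
        · exact ⟨0, by omega, .inr ⟨rfl, h₃⟩⟩
      · simp only [BExp.Holds, NExp.eval, Nat.le_zero] at ht
        exact absurd ht h23
    · exact Nat.mul_le_mul (by omega) (by simp [BExp.cost, NExp.cost])
    · rintro s₂ ⟨⟨j, ⟨k, -, hI⟩ | ⟨-, -, h₂⟩⟩, hb⟩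
      · simp only [BExp.Holds, NExp.eval, Nat.le_zero] at hb
        exact absurd hI.running hb
      · exact h₂
  · nlinarith [Nat.zero_le (D * D * D), Nat.zero_le (D * D)]

/-- Insert all rows, until an insertion fails. -/
def insertRows : Prog :=
  .while (.and (.natLT (.var 22) (.var 20)) (.natLE (.var 30) (.const 0))) insertRow

theorem insertRows_spec (s : Mem) {K N D : ℕ} (h20 : s.nat 20 0 0 = N) (h21 : s.nat 21 0 0 = K)
    (hK : K ≤ D) (hN : N ≤ D) (h22 : s.nat 22 0 0 = 0) (h30 : s.nat 30 0 0 = 0)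
    (h13 : ∀ c, s.nat 13 0 c = 0) (h2 : ∀ c, s.real 2 0 c = 0) :
    WP insertRows ((D + 4) * ((D + 4) * ((D + 4) * ((D + 4) * 2000))))
      (fun s' => RowInv s K N s' ∨ ∃ r < N, FailInv s K r s') s := by
  -- The empty assignment with all prices `0`.
  have h0 : RowInv s K 0 s := ⟨Frame.refl _ _ _, h22, h30, by simp, by simp, by simp,
    fun c _ => by simp [h13], fun c _ => by simp [h2], fun c _ _ => h2 c, by simp⟩
  refine (WP.while (T := (D + 4) * ((D + 4) * ((D + 4) * 2000))) (fun j s' =>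
    (∃ r, j + r = N ∧ RowInv s K r s') ∨ j = 0 ∧ ∃ r < N, FailInv s K r s') ?_ N s
    (.inl ⟨0, rfl, h0⟩)).mono ?_ ?_
  · rintro j s' h ht
    simp only [BExp.Holds, NExp.eval, Nat.le_zero, not_le] at ht
    rcases h with ⟨r, hj, hI⟩ | ⟨-, r, -, hI⟩
    · have e20 : s'.nat 20 = s.nat 20 := hI.frame.1 20 (by simp)
      rw [hI.row, e20, h20] at ht
      refine (insertRow_spec s s' h21 hK (by omega) hI).mono le_rfl ?_
      rintro s₂ (h₂ | h₂)
      · exact ⟨j - 1, by omega, .inl ⟨r + 1, by omega, h₂⟩⟩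
      · exact ⟨0, by omega, .inr ⟨rfl, r, ht.1, h₂⟩⟩
    · exact absurd ht.2 hI.fail
  · simp only [BExp.cost, NExp.cost]
    nlinarith [Nat.mul_le_mul hN (le_refl ((D + 4) * ((D + 4) * ((D + 4) * 2000)))),
      Nat.zero_le (D * D * D), Nat.zero_le (D * D), Nat.zero_le D]
  · rintro s' ⟨⟨j, h⟩, hb⟩
    simp only [BExp.Holds, NExp.eval, Nat.le_zero, not_le] at hb
    rcases h with ⟨r, hj, hI⟩ | ⟨-, hI⟩
    · have e20 : s'.nat 20 = s.nat 20 := hI.frame.1 20 (by simp)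
      rw [hI.row, e20, h20, hI.fail] at hb
      obtain rfl : r = N := by
        by_contra hne
        exact hb ⟨by omega, rfl⟩
      exact .inl hI
    · exact .inr hI

end RowMatching

namespace WHA

open RealRAM

/-!
# Reduction to row-perfect matchings

Each project `p` has `n + 1` slots, the rows `p * (n + 1) + i` with `i ≤ n`.  The columns are the
applicants and one private null column `n + b` for each row `b`, which is admissible unless the
slot must be filled.
-/

/-- The column `c` is admissible for the slot `b`; `s` is the initial memory. -/
def SlotAdj (s : Mem) (n b c : ℕ) : Prop :=
  (c < n ∧ s.nat 1 c (b / (n + 1)) ≠ 0 ∧ s.nat 4 0 (b / (n + 1)) ≠ 0 ∧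
    b % (n + 1) < s.nat 3 0 (b / (n + 1))) ∨
  (c = n + b ∧ ¬ (s.nat 4 0 (b / (n + 1)) ≠ 0 ∧ b % (n + 1) < s.nat 2 0 (b / (n + 1))))

/-- Weight of the column `c` for the slot `b`; `s` is the initial memory. -/
noncomputable def slotWeight (s : Mem) (n b c : ℕ) : ℝ :=
  if c < n then s.real 0 c (b / (n + 1)) else 0

variable {n m : ℕ}

open Classical in
/-- The edge set given by an assignment of columns to slots. -/
noncomputable def slotMatching (n m : ℕ) (x : ℕ → ℕ) : Finset (Fin n × Fin m) :=
  {e | ∃ b < m * (n + 1), x b = e.1 ∧ b / (n + 1) = e.2}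

theorem mem_slotMatching {x : ℕ → ℕ} {a : Fin n} {p : Fin m} :
    (a, p) ∈ slotMatching n m x ↔ ∃ b < m * (n + 1), x b = a ∧ b / (n + 1) = p := by
  simp [slotMatching]

theorem slot_div_lt {b : ℕ} (hb : b < m * (n + 1)) : b / (n + 1) < m :=
  Nat.div_lt_of_lt_mul (by rwa [mul_comm])

theorem slot_lt (p : Fin m) {i : ℕ} (hi : i < n + 1) : p * (n + 1) + i < m * (n + 1) := by
  have := Nat.mul_le_mul_right (n + 1) (Nat.succ_le_of_lt p.2)
  rw [Nat.succ_mul] at this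
  omega

theorem slot_div (p : ℕ) {i : ℕ} (hi : i < n + 1) : (p * (n + 1) + i) / (n + 1) = p := by
  rw [mul_comm, Nat.mul_add_div (by omega), Nat.div_eq_of_lt hi, add_zero]

theorem slot_mod (p : ℕ) {i : ℕ} (hi : i < n + 1) : (p * (n + 1) + i) % (n + 1) = i := by
  rw [mul_comm, Nat.mul_add_mod, Nat.mod_eq_of_lt hi]

section Input

variable (I : WHA n m) (S : Finset (Fin m))

theorem input_edge (a : Fin n) (p : Fin m) : (I.input S).nat 1 a p ≠ 0 ↔ (a, p) ∈ I.edges := by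
  simp [input]

theorem input_lower (p : Fin m) : (I.input S).nat 2 0 p = I.lower p := by
  simp [input]

theorem input_upper (p : Fin m) : (I.input S).nat 3 0 p = I.upper p := by
  simp [input]

theorem input_open (p : Fin m) : (I.input S).nat 4 0 p ≠ 0 ↔ p ∈ S := by
  simp [input]

theorem input_weight (a : Fin n) (p : Fin m) : (I.input S).real 0 a p = I.weightFn (a, p) := by
  simp [input]

end Input

/-! ### Slot assignments and matchings -/

variable {I : WHA n m} {S : Finset (Fin m)}

theorem slotAdj_lt {x : ℕ → ℕ} {b : ℕ} (hadj : SlotAdj (I.input S) n b (x b)) {a : Fin n}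
    {p : Fin m} (ha : x b = a) (hp : b / (n + 1) = p) :
    (a, p) ∈ I.edges ∧ p ∈ S ∧ b % (n + 1) < I.upper p := by
  rcases hadj with ⟨h1, h2, h3, h4⟩ | ⟨h1, -⟩
  · rw [hp] at h2 h3 h4
    rw [ha] at h2
    exact ⟨(input_edge I S a p).1 h2, (input_open I S p).1 h3, by rwa [input_upper] at h4⟩
  · have := a.2
    omega

/-- Null columns contribute `0`; the slots holding applicants are in bijection with the edges of the
matching. -/
theorem sum_slotWeight {x : ℕ → ℕ}
    (inj : ∀ b < m * (n + 1), ∀ b' < m * (n + 1), x b = x b' → b = b') :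
    ∑ b ∈ Finset.range (m * (n + 1)), slotWeight (I.input S) n b (x b)
      = I.totalWeight (slotMatching n m x) := by
  unfold totalWeight slotWeight
  rw [← Finset.sum_filter]
  refine Finset.sum_bij
    (fun b hb => (⟨x b, (Finset.mem_filter.1 hb).2⟩,
      ⟨b / (n + 1), slot_div_lt (Finset.mem_range.1 (Finset.mem_filter.1 hb).1)⟩)) ?_ ?_ ?_ ?_
  · intro b hb
    exact mem_slotMatching.2 ⟨b, Finset.mem_range.1 (Finset.mem_filter.1 hb).1, rfl, rfl⟩
  · intro b hb b' hb' e
    simp only [Prod.mk.injEq, Fin.mk.injEq] at e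
    exact inj b (Finset.mem_range.1 (Finset.mem_filter.1 hb).1) b'
      (Finset.mem_range.1 (Finset.mem_filter.1 hb').1) e.1
  · rintro ⟨a, p⟩ he
    obtain ⟨b, hb, ha, hp⟩ := mem_slotMatching.1 he
    refine ⟨b, Finset.mem_filter.2 ⟨Finset.mem_range.2 hb, by rw [ha]; exact a.2⟩, ?_⟩
    ext <;> simp [ha, hp]
  · intro b hb
    exact input_weight I S ⟨x b, (Finset.mem_filter.1 hb).2⟩ ⟨b / (n + 1), _⟩

theorem slotMatching_opensExactly {x : ℕ → ℕ}
    (hadj : ∀ b < m * (n + 1), SlotAdj (I.input S) n b (x b))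
    (inj : ∀ b < m * (n + 1), ∀ b' < m * (n + 1), x b = x b' → b = b') :
    I.OpensExactly S (slotMatching n m x) := by
  constructor
  · intro p hp
    constructor
    -- Slots that must be filled have no null column, so they hold distinct applicants.
    · have hsub : (Finset.range (min (I.lower p) (n + 1))).image (fun i => x (p * (n + 1) + i))
          ⊆ (assigned (slotMatching n m x) p).image Fin.val := by
        intro c hc
        obtain ⟨i, hi, rfl⟩ := Finset.mem_image.1 hc
        obtain ⟨hi, hi'⟩ := lt_min_iff.1 (Finset.mem_range.1 hi)
        have hlt := slot_lt p hi'
        rcases hadj _ hlt with ⟨h1, -⟩ | ⟨-, h2⟩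
        · refine Finset.mem_image.2 ⟨⟨_, h1⟩, ?_, rfl⟩
          simp only [assigned, Finset.mem_filter, Finset.mem_univ, true_and]
          exact mem_slotMatching.2 ⟨_, hlt, rfl, slot_div _ hi'⟩
        · rw [slot_div _ hi', slot_mod _ hi', input_lower] at h2
          exact absurd ⟨(input_open I S p).2 hp, hi⟩ h2
      have hcard := Finset.card_le_card hsub
      rw [Finset.card_image_of_injOn, Finset.card_image_of_injective _ Fin.val_injective,
        Finset.card_range] at hcard
      -- At most `n` applicants exist, so the minimum cannot be `n + 1` and equals the lower quota.
      -- With only `n` slots, a lower quota above `n` would go unnoticed.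
      · have := Finset.card_le_univ (assigned (slotMatching n m x) p)
        rw [Fintype.card_fin] at this
        omega
      · intro i hi i' hi' e
        have hi := (lt_min_iff.1 (Finset.mem_range.1 hi)).2
        have hi' := (lt_min_iff.1 (Finset.mem_range.1 hi')).2
        have := inj _ (slot_lt p hi) _ (slot_lt p hi') e
        omega
    · have hsub : (assigned (slotMatching n m x) p).image Fin.val
          ⊆ (Finset.range (I.upper p)).image (fun i => x (p * (n + 1) + i)) := by
        intro c hc
        obtain ⟨a, ha, rfl⟩ := Finset.mem_image.1 hc
        simp only [assigned, Finset.mem_filter, Finset.mem_univ, true_and] at ha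
        obtain ⟨b, hb, ha, hbp⟩ := mem_slotMatching.1 ha
        obtain ⟨-, -, hu⟩ := slotAdj_lt (hadj b hb) ha hbp
        refine Finset.mem_image.2 ⟨b % (n + 1), Finset.mem_range.2 hu, ?_⟩
        rw [← hbp, mul_comm, Nat.div_add_mod, ha]
      have hcard := (Finset.card_le_card hsub).trans Finset.card_image_le
      rwa [Finset.card_image_of_injective _ Fin.val_injective, Finset.card_range] at hcard
  · intro p hp
    unfold IsClosedIn
    rw [Finset.card_eq_zero, assigned, Finset.filter_eq_empty_iff]
    intro a _ ha
    obtain ⟨b, hb, ha, hbp⟩ := mem_slotMatching.1 ha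
    exact hp (slotAdj_lt (hadj b hb) ha hbp).2.1

theorem slotMatching_isMatching {x : ℕ → ℕ}
    (hadj : ∀ b < m * (n + 1), SlotAdj (I.input S) n b (x b))
    (inj : ∀ b < m * (n + 1), ∀ b' < m * (n + 1), x b = x b' → b = b') :
    I.IsMatching (slotMatching n m x) where
  subset := by
    rintro ⟨a, p⟩ he
    obtain ⟨b, hb, ha, hp⟩ := mem_slotMatching.1 he
    exact (slotAdj_lt (hadj b hb) ha hp).1
  applicant a := by
    rw [Finset.card_le_one]
    intro p hp p' hp'
    simp only [Finset.mem_filter, Finset.mem_univ, true_and] at hp hp'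
    obtain ⟨b, hb, ha, hbp⟩ := mem_slotMatching.1 hp
    obtain ⟨b', hb', ha', hbp'⟩ := mem_slotMatching.1 hp'
    obtain rfl := inj b hb b' hb' (ha.trans ha'.symm)
    exact Fin.ext (hbp.symm.trans hbp')
  project p := by
    have h := slotMatching_opensExactly hadj inj
    by_cases hp : p ∈ S
    · exact .inr (h.1 p hp)
    · exact .inl (h.2 p hp)

/-- The applicants of a project are numbered so that they fill an initial segment of its slots, as
the quota conditions on slot indices require. -/
theorem exists_enumeration (A : Finset (Fin n)) : ∃ g : ℕ → ℕ,
    (∀ i < A.card, ∃ a ∈ A, g i = (a : ℕ)) ∧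
    (∀ i < A.card, ∀ i' < A.card, g i = g i' → i = i') ∧
    ∀ a ∈ A, ∃ i < A.card, g i = (a : ℕ) := by
  refine ⟨fun i => if h : i < A.card then (A.equivFin.symm ⟨i, h⟩ : Fin n) else 0, ?_, ?_, ?_⟩
  · intro i hi
    exact ⟨A.equivFin.symm ⟨i, hi⟩, (A.equivFin.symm ⟨i, hi⟩).2, by simp [hi]⟩
  · intro i hi i' hi' e
    simp only [hi, hi', dif_pos] at e
    simpa using A.equivFin.symm.injective (Subtype.ext (Fin.ext e))
  · intro a ha
    exact ⟨A.equivFin ⟨a, ha⟩, (A.equivFin ⟨a, ha⟩).2, by simp⟩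

/-- Every matching that opens exactly the projects in `S` comes from an assignment of slots. -/
theorem exists_slots {M : Finset (Fin n × Fin m)} (hM : I.IsMatching M) (hS : I.OpensExactly S M) :
    ∃ z : ℕ → ℕ,
      (∀ b < m * (n + 1), z b < n + m * (n + 1) ∧ SlotAdj (I.input S) n b (z b)) ∧
      (∀ b < m * (n + 1), ∀ b' < m * (n + 1), z b = z b' → b = b') ∧ slotMatching n m z = M := by
  choose g hmem hinj hsurj using fun p : Fin m => exists_enumeration (assigned M p)
  have hmemM : ∀ {a p}, a ∈ assigned M p ↔ (a, p) ∈ M := by simp [assigned]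
  let z : ℕ → ℕ := fun b => if h : b / (n + 1) < m then
    (if b % (n + 1) < (assigned M ⟨b / (n + 1), h⟩).card then g ⟨b / (n + 1), h⟩ (b % (n + 1))
      else n + b) else n + b
  have hz : ∀ b < m * (n + 1), ∃ p : Fin m, b / (n + 1) = p ∧
      ((b % (n + 1) < (assigned M p).card ∧ z b = g p (b % (n + 1)) ∧
          ∃ a, (a, p) ∈ M ∧ z b = (a : ℕ)) ∨
        ((assigned M p).card ≤ b % (n + 1) ∧ z b = n + b)) := by
    intro b hb
    refine ⟨⟨b / (n + 1), slot_div_lt hb⟩, rfl, ?_⟩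
    by_cases h : b % (n + 1) < (assigned M ⟨b / (n + 1), slot_div_lt hb⟩).card
    · have e : z b = g ⟨b / (n + 1), slot_div_lt hb⟩ (b % (n + 1)) := by
        simp [z, slot_div_lt hb, h]
      obtain ⟨a, ha, hg⟩ := hmem _ _ h
      exact .inl ⟨h, e, a, hmemM.1 ha, e.trans hg⟩
    · exact .inr ⟨not_lt.1 h, by simp [z, h]⟩
  refine ⟨z, ?_, ?_, ?_⟩
  · intro b hb
    obtain ⟨p, hp, ⟨hi, -, a, ha, e⟩ | ⟨hi, e⟩⟩ := hz b hb
    · have hpS : p ∈ S := by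
        by_contra hpS
        have := hS.2 p hpS
        unfold IsClosedIn at this
        omega
      have := (hS.1 p hpS).2
      rw [e]
      refine ⟨by have := a.2; omega, .inl ⟨a.2, ?_, ?_, ?_⟩⟩
      · rw [hp]; exact (input_edge I S a p).2 (hM.subset ha)
      · rw [hp]; exact (input_open I S p).2 hpS
      · rw [hp, input_upper]; omega
    · rw [e]
      refine ⟨by omega, .inr ⟨rfl, ?_⟩⟩
      rw [hp, input_open, input_lower]
      rintro ⟨hpS, hl⟩
      have := (hS.1 p hpS).1
      omega
  · intro b hb b' hb' e
    obtain ⟨p, hp, ⟨hi, eg, a, ha, ea⟩ | ⟨hi, eb⟩⟩ := hz b hb <;>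
      obtain ⟨p', hp', ⟨hi', eg', a', ha', ea'⟩ | ⟨hi', eb'⟩⟩ := hz b' hb'
    -- Equal columns below `n` mean the same applicant, who has only one project; the enumeration of
    -- that project then determines the slot. Null columns start at `n` and are private.
    · obtain rfl : a = a' := Fin.ext (by omega)
      obtain rfl : p = p' := Finset.card_le_one.1 (hM.applicant a) p (by simpa using ha) p'
        (by simpa using ha')
      have := hinj p _ hi _ hi' (by rw [← eg, ← eg', e])
      rw [← Nat.div_add_mod b (n + 1), ← Nat.div_add_mod b' (n + 1), hp, hp', this]
    · have := a.2; omega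
    · have := a'.2; omega
    · omega
  · ext ⟨a, p⟩
    rw [mem_slotMatching]
    constructor
    · rintro ⟨b, hb, ha, hbp⟩
      obtain ⟨p', hp', ⟨hi, -, a', ha', e⟩ | ⟨-, e⟩⟩ := hz b hb
      · obtain rfl : a = a' := Fin.ext (by omega)
        obtain rfl : p = p' := Fin.ext (by omega)
        exact ha'
      · have := a.2; omega
    · intro he
      obtain ⟨i, hi, hg⟩ := hsurj p a (hmemM.2 he)
      have hin : i < n + 1 := by
        have := Finset.card_le_univ (assigned M p)
        rw [Fintype.card_fin] at this
        omega
      refine ⟨p * (n + 1) + i, slot_lt p hin, ?_, slot_div _ hin⟩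
      simp only [z, slot_div _ hin, slot_mod _ hin, p.2, dif_pos, Fin.eta, hi, if_pos, hg]

end WHA

/-! ### The complete program: slot table, assignment, output -/

namespace WHA

open RealRAM RowMatching

/-- The current applicant is admissible for the current slot. -/
def edgeTest : BExp :=
  .and (.natLT (.const 0) (.get 1 (.var 33) (.var 31)))
    (.and (.natLT (.const 0) (.at 4 (.var 31))) (.natLT (.var 32) (.at 3 (.var 31))))

/-- The current slot must be filled. -/
def mustFillTest : BExp :=
  .and (.natLT (.const 0) (.at 4 (.var 31))) (.natLT (.var 32) (.at 2 (.var 31)))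

/-- Write the entries of the current slot in the columns of the applicants. -/
def buildApplicants : Prog :=
  .for 33 (.var 0) (.seq (.setReal 1 (.var 20) (.var 33) (.get 0 (.var 33) (.var 31)))
    (.ite edgeTest (.setNat 8 (.var 20) (.var 33) (.const 1)) .skip))

/-- Write the row of the current slot. -/
def buildRow : Prog :=
  .seq buildApplicants
    (.seq (.ite mustFillTest .skip (.setNat 8 (.var 20) (.add (.var 0) (.var 20)) (.const 1)))
      (.seq (.assignAt 9 (.var 20) (.var 31)) (.assign 20 (.add (.var 20) (.const 1)))))

/-- Write the admissibility relation and the weights of the slots. -/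
def build : Prog :=
  .seq (.for 31 (.at 0 (.const 1)) (.for 32 (.add (.var 0) (.const 1)) buildRow))
    (.assign 21 (.add (.var 0) (.var 20)))

/-- The first `r` rows are written. -/
structure Built (s : Mem) (n r : ℕ) (s' : Mem) : Prop where
  frame : Frame [8, 9, 20, 21, 31, 32, 33] [1] s s'
  rows : s'.nat 20 0 0 = r
  adj : ∀ b < r, ∀ c, s'.nat 8 b c ≠ 0 ↔ SlotAdj s n b c
  weight : ∀ b < r, ∀ c, s'.real 1 b c = slotWeight s n b c
  project : ∀ b < r, s'.nat 9 0 b = b / (n + 1)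
  adj_zero : ∀ b ≥ r, ∀ c, s'.nat 8 b c = 0
  weight_zero : ∀ b ≥ r, ∀ c, s'.real 1 b c = 0

theorem Built.setNat {s s' : Mem} {n r : ℕ} (h : Built s n r s') {k : ℕ} (hk : k ∈ [21, 31, 32, 33])
    (v : ℕ) : Built s n r (s'.setNat k 0 0 v) := by
  have h8 : 8 ≠ k := by rintro rfl; simp at hk
  have h9 : 9 ≠ k := by rintro rfl; simp at hk
  have h20 : 20 ≠ k := by rintro rfl; simp at hk
  refine ⟨h.frame.setNat (by simp at hk ⊢; omega) _ _ _, ?_, ?_, h.weight, ?_, ?_, h.weight_zero⟩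
  · rw [Mem.setNat_nat_of_ne _ _ _ _ _ h20]; exact h.rows
  · rw [Mem.setNat_nat_of_ne _ _ _ _ _ h8]; exact h.adj
  · rw [Mem.setNat_nat_of_ne _ _ _ _ _ h9]; exact h.project
  · rw [Mem.setNat_nat_of_ne _ _ _ _ _ h8]; exact h.adj_zero

theorem buildApplicants_spec {s s' : Mem} {n r p i : ℕ} (h : Built s n r s')
    (hn : s.nat 0 0 0 = n) (hp : s'.nat 31 0 0 = p) (hi : s'.nat 32 0 0 = i) :
    WP buildApplicants ((n + 2) * 100) (fun s₁ => Frame [8, 33] [1] s' s₁ ∧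
      (∀ b ≠ r, s₁.nat 8 b = s'.nat 8 b) ∧ (∀ b ≠ r, s₁.real 1 b = s'.real 1 b) ∧
      (∀ c, s₁.nat 8 r c ≠ 0 ↔ c < n ∧ s.nat 1 c p ≠ 0 ∧ s.nat 4 0 p ≠ 0 ∧ i < s.nat 3 0 p) ∧
      ∀ c, s₁.real 1 r c = if c < n then s.real 0 c p else 0) s' := by
  have e0 : s'.nat 0 = s.nat 0 := h.frame.1 0 (by simp)
  refine WP.for (B := n) (T := 70) (fun a s₁ => Frame [8, 33] [1] s' s₁ ∧
    (∀ b ≠ r, s₁.nat 8 b = s'.nat 8 b) ∧ (∀ b ≠ r, s₁.real 1 b = s'.real 1 b) ∧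
    (∀ c, s₁.nat 8 r c ≠ 0 ↔ c < a ∧ s.nat 1 c p ≠ 0 ∧ s.nat 4 0 p ≠ 0 ∧ i < s.nat 3 0 p) ∧
    ∀ c, s₁.real 1 r c = if c < a then s.real 0 c p else 0) ?_ ?_ ?_ ?_ ?_
  · refine ⟨(Frame.refl _ _ _).setNat (by simp) _ _ _, by simp, by simp, ?_, ?_⟩
    · simp [h.adj_zero r le_rfl]
    · simp [h.weight_zero r le_rfl]
  · rintro a s₁ ⟨hF, -⟩
    have : s₁.nat 0 = s'.nat 0 := hF.1 0 (by simp)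
    simp [NExp.eval, this, e0, hn]
  · rintro a ha s₁ ⟨hF, h8, h1, hadj, hw⟩ h33
    have f0 : s₁.real 0 = s.real 0 := by rw [hF.2 0 (by simp), h.frame.2 0 (by simp)]
    have g1 : s₁.nat 1 = s.nat 1 := by rw [hF.1 1 (by simp), h.frame.1 1 (by simp)]
    have g3 : s₁.nat 3 = s.nat 3 := by rw [hF.1 3 (by simp), h.frame.1 3 (by simp)]
    have g4 : s₁.nat 4 = s.nat 4 := by rw [hF.1 4 (by simp), h.frame.1 4 (by simp)]
    have g20 : s₁.nat 20 0 0 = r := by rw [hF.1 20 (by simp), h.rows]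
    have g31 : s₁.nat 31 0 0 = p := by rw [hF.1 31 (by simp), hp]
    have g32 : s₁.nat 32 0 0 = i := by rw [hF.1 32 (by simp), hi]
    have lt_succ : ∀ c, c ≠ a → (c < a + 1 ↔ c < a) := fun c hc => by omega
    refine (WP.seq (T := 15) (T' := 50) (WP.setReal ?_ (by decide))).mono (by omega) fun _ h => h
    simp only [NExp.eval, RExp.eval, g20, g31, h33, f0]
    have hF₂ : Frame [8, 33] [1] s' (s₁.setReal 1 r a (s.real 0 a p)) :=
      hF.setReal (by simp) _ _ _
    have hother : ∀ b ≠ r, (s₁.setReal 1 r a (s.real 0 a p)).real 1 b = s'.real 1 b := by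
      intro b hb
      rw [← h1 b hb]
      funext c
      simp [Mem.setReal_real_self, hb]
    have hrow : ∀ c, (s₁.setReal 1 r a (s.real 0 a p)).real 1 r c
        = if c < a + 1 then s.real 0 c p else 0 := by
      intro c
      rw [Mem.setReal_real_self, hw]
      by_cases hc : c = a
      · simp [hc]
      · simp [hc, lt_succ c hc]
    refine (WP.ite (T := 15) (fun ht => ?_) (fun ht => ?_)).mono (by decide) fun _ h => h
    · simp only [edgeTest, BExp.Holds, NExp.eval, Mem.setReal_nat, h33, g31, g32, g1, g3, g4,
        Nat.le_zero, not_le] at ht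
      refine WP.setNat ?_ (by decide)
      simp only [NExp.eval, Mem.setReal_nat, g20, h33]
      refine ⟨by simpa using h33, (hF₂.setNat (by simp) _ _ _).setNat (by simp) _ _ _, ?_,
        hother, ?_, hrow⟩
      · intro b hb
        rw [← h8 b hb]
        funext c
        simp [Mem.setNat_nat_self, hb]
      · intro c
        by_cases hc : c = a
        · simpa [hc, Mem.setNat_nat_self] using ht
        · simpa [hc, Mem.setNat_nat_self, lt_succ c hc] using hadj c
    · simp only [edgeTest, BExp.Holds, NExp.eval, Mem.setReal_nat, h33, g31, g32, g1, g3, g4,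
        Nat.le_zero, not_le] at ht
      refine WP.skip ⟨h33, hF₂.setNat (by simp) _ _ _, ?_, hother, ?_, hrow⟩ (by decide)
      · simpa using h8
      · intro c
        by_cases hc : c = a
        -- Column `a` of this row has not been written yet, so its entry is still `0`.
        · have := (hadj c).not.2 (by omega)
          subst hc
          simp only [ne_eq, not_not] at this
          simp [this]
          simpa using ht
        · simpa [lt_succ c hc] using hadj c
  · rintro s₁ - h₁
    exact h₁
  · simp only [NExp.cost]
    exact Nat.mul_le_mul (by omega) (by omega)

/-- The machine neither multiplies nor divides: the row number is a running counter, and the project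
of each row is stored in array `9`. -/
theorem buildRow_spec {s s' : Mem} {n p i : ℕ} (h : Built s n (p * (n + 1) + i) s')
    (hn : s.nat 0 0 0 = n) (hp : s'.nat 31 0 0 = p) (hi : s'.nat 32 0 0 = i) (hin : i < n + 1) :
    WP buildRow ((n + 3) * 100) (fun s₁ => Built s n (p * (n + 1) + i + 1) s₁ ∧
      s₁.nat 31 0 0 = p ∧ s₁.nat 32 0 0 = i) s' := by
  set r := p * (n + 1) + i with hr
  have hdiv : r / (n + 1) = p := slot_div p hin
  have hmod : r % (n + 1) = i := slot_mod p hin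
  refine (WP.seq (T' := 100)
    ((buildApplicants_spec h hn hp hi).mono le_rfl ?_)).mono (by omega) fun _ h => h
  rintro s₁ ⟨hF, h8, h1, hadj, hw⟩
  have hF' := h.frame.trans (hF.mono (by simp) (by simp))
  have f0 : s₁.nat 0 = s.nat 0 := hF'.1 0 (by simp)
  have f2 : s₁.nat 2 = s.nat 2 := hF'.1 2 (by simp)
  have f4 : s₁.nat 4 = s.nat 4 := hF'.1 4 (by simp)
  have f9 : s₁.nat 9 = s'.nat 9 := hF.1 9 (by simp)
  have g20 : s₁.nat 20 0 0 = r := by rw [hF.1 20 (by simp), h.rows]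
  have g31 : s₁.nat 31 0 0 = p := by rw [hF.1 31 (by simp), hp]
  have g32 : s₁.nat 32 0 0 = i := by rw [hF.1 32 (by simp), hi]
  -- The common tail of the two branches, which differ only in whether the null column is admitted.
  have key : ∀ s₂ : Mem, Frame [8] [] s₁ s₂ → (∀ b ≠ r, s₂.nat 8 b = s₁.nat 8 b) →
      (∀ c, s₂.nat 8 r c ≠ 0 ↔ SlotAdj s n r c) →
      WP (.seq (.assignAt 9 (.var 20) (.var 31)) (.assign 20 (.add (.var 20) (.const 1)))) 30
        (fun s₁ => Built s n (r + 1) s₁ ∧ s₁.nat 31 0 0 = p ∧ s₁.nat 32 0 0 = i) s₂ := by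
    intro s₂ hF₂ h8' hrow
    have k9 : s₂.nat 9 = s'.nat 9 := by rw [hF₂.1 9 (by simp), f9]
    have k1 : s₂.real 1 = s₁.real 1 := hF₂.2 1 (by simp)
    have k20 : s₂.nat 20 0 0 = r := by rw [hF₂.1 20 (by simp), g20]
    have k31 : s₂.nat 31 0 0 = p := by rw [hF₂.1 31 (by simp), g31]
    have k32 : s₂.nat 32 0 0 = i := by rw [hF₂.1 32 (by simp), g32]
    refine WP.straight rfl (by decide) ⟨⟨?_, ?_, ?_, ?_, ?_, ?_, ?_⟩, ?_, ?_⟩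
    · exact ((hF'.trans (hF₂.mono (by simp) (by simp))).setNat (by simp) _ _ _).setNat
        (by simp) _ _ _
    · simp [Prog.exec, NExp.eval, k20]
    · intro b hb c
      simp only [Prog.exec, ne_eq, Nat.reduceEqDiff, not_false_eq_true, Mem.setNat_nat_of_ne]
      by_cases hbr : b = r
      · subst hbr; exact hrow c
      · rw [h8' b hbr, h8 b hbr]; exact h.adj b (by omega) c
    · intro b hb c
      simp only [Prog.exec, Mem.setNat_real, k1]
      by_cases hbr : b = r
      · subst hbr; rw [hw c, slotWeight, hdiv]
      · rw [h1 b hbr]; exact h.weight b (by omega) c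
    · intro b hb
      by_cases hbr : b = r
      · simp [Prog.exec, NExp.eval, k20, k31, hbr, hdiv]
      · simp [Prog.exec, NExp.eval, k20, k31, hbr, k9, h.project b (by omega)]
    · intro b hb c
      simp only [Prog.exec, ne_eq, Nat.reduceEqDiff, not_false_eq_true, Mem.setNat_nat_of_ne]
      rw [h8' b (by omega), h8 b (by omega)]; exact h.adj_zero b (by omega) c
    · intro b hb c
      simp only [Prog.exec, Mem.setNat_real, k1]
      rw [h1 b (by omega)]; exact h.weight_zero b (by omega) c
    · simpa [Prog.exec] using k31
    · simpa [Prog.exec] using k32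
  have htest : mustFillTest.Holds s₁ ↔ s.nat 4 0 p ≠ 0 ∧ i < s.nat 2 0 p := by
    simp [mustFillTest, BExp.Holds, NExp.eval, f2, f4, g31, g32]
  refine WP.seq (T := 70) (T' := 30)
    ((WP.ite (T := 30) (fun ht => ?_) (fun ht => ?_)).mono (by decide) fun _ h => h)
  · rw [htest] at ht
    refine WP.skip (key s₁ (Frame.refl _ _ _) (fun _ _ => rfl) ?_) (by decide)
    intro c
    rw [hadj, SlotAdj, hdiv, hmod]
    exact ⟨.inl, fun h => h.resolve_right fun h => h.2 ht⟩
  · rw [htest] at ht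
    refine WP.setNat (key _ ((Frame.refl _ _ _).setNat (by simp) _ _ _) ?_ ?_) (by decide)
    · intro b hb
      funext c
      simp [Mem.setNat_nat_self, NExp.eval, g20, hb]
    · intro c
      rw [SlotAdj, hdiv, hmod, ← hadj c]
      simp only [NExp.eval, g20, f0, hn, Mem.setNat_nat_self, true_and]
      by_cases hc : c = n + r
      · simp only [hc, if_true, true_and]
        exact ⟨fun _ => .inr ht, fun _ => one_ne_zero⟩
      · simp [hc]

theorem build_spec (s : Mem) {n m : ℕ} (hn : s.nat 0 0 0 = n) (hm : s.nat 0 0 1 = m)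
    (h20 : s.nat 20 0 0 = 0) (h8 : ∀ b c, s.nat 8 b c = 0) (h1 : ∀ b c, s.real 1 b c = 0) :
    WP build ((m + 3) * ((n + 4) * ((n + 4) * 200)))
      (fun s' => Built s n (m * (n + 1)) s' ∧ s'.nat 21 0 0 = n + m * (n + 1)) s := by
  refine (WP.seq (T := (m + 2) * ((n + 4) * ((n + 4) * 200))) (T' := 20)
    (WP.for (B := m) (T := (n + 3) * ((n + 3) * 150))
      (fun p s' => Built s n (p * (n + 1)) s') ?_ ?_ ?_ ?_ ?_)).mono ?_ fun _ h => h
  · exact ⟨(Frame.refl _ _ _).setNat (by simp) _ _ _, by simpa using h20, by simp, by simp,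
      by simp, by simpa using h8, by simpa using h1⟩
  · rintro p s' h
    have : s'.nat 0 = s.nat 0 := h.frame.1 0 (by simp)
    simp [NExp.eval, this, hm]
  · rintro p hp s' h h31
    refine WP.for (B := n + 1) (T := (n + 3) * 100)
      (fun i s' => Built s n (p * (n + 1) + i) s' ∧ s'.nat 31 0 0 = p) ?_ ?_ ?_ ?_ ?_
    · exact ⟨h.setNat (by simp) 0, by simpa using h31⟩
    · rintro i s' ⟨h, -⟩
      have : s'.nat 0 = s.nat 0 := h.frame.1 0 (by simp)
      simp [NExp.eval, this, hn]
    · rintro i hi s₁ ⟨h₁, h31⟩ h32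
      refine (buildRow_spec h₁ hn h31 h32 hi).mono le_rfl ?_
      rintro s₂ ⟨h₂, k31, k32⟩
      exact ⟨k32, h₂.setNat (by simp) _, by simpa using k31⟩
    · rintro s₁ - ⟨h₁, h31⟩
      refine ⟨h31, ?_⟩
      rw [Nat.succ_mul]
      exact h₁.setNat (by simp) _
    · simp only [NExp.cost]
      exact Nat.mul_le_mul (by omega) (by omega)
  · rintro s' - h
    have e0 : s'.nat 0 = s.nat 0 := h.frame.1 0 (by simp)
    refine WP.setNat ⟨h.setNat (by simp) _, ?_⟩ (by decide)
    simp [NExp.eval, e0, hn, h.rows]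
  · simp only [NExp.cost]
    exact Nat.mul_le_mul le_rfl (by nlinarith)
  · nlinarith [Nat.zero_le (n * n)]

/-- Write the answer. -/
def writeAnswer : Prog :=
  .seq (.assign 5 (.const 1)) (.for 26 (.var 20)
    (.setNat 6 (.at 10 (.var 26)) (.at 9 (.var 26)) (.const 1)))

/-- Null columns are written too, but when the first `n` columns are the applicants they land in
rows of array `6` from `n` on, which `output` does not read. -/
theorem writeAnswer_spec (s : Mem) {N : ℕ} (h20 : s.nat 20 0 0 = N) (h6 : ∀ a p, s.nat 6 a p = 0) :
    WP writeAnswer ((N + 3) * 50) (fun s' => s'.nat 5 0 0 = 1 ∧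
      ∀ a p, s'.nat 6 a p = 1 ↔ ∃ b < N, s.nat 10 0 b = a ∧ s.nat 9 0 b = p) s := by
  refine (WP.seq (T := 10) (T' := (N + 2) * 50) (WP.setNat ?_ (by decide))).mono (by omega)
    fun _ h => h
  refine WP.for (B := N) (T := 20) (fun j s' => Frame [5, 6, 26] [] s s' ∧ s'.nat 5 0 0 = 1 ∧
    ∀ a p, s'.nat 6 a p = 1 ↔ ∃ b < j, s.nat 10 0 b = a ∧ s.nat 9 0 b = p) ?_ ?_ ?_ ?_ ?_
  · exact ⟨((Frame.refl _ _ _).setNat (by simp) _ _ _).setNat (by simp) _ _ _,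
      by simp [NExp.eval], by simp [h6]⟩
  · rintro j s' ⟨hF, -⟩
    have : s'.nat 20 = s.nat 20 := hF.1 20 (by simp)
    simp [NExp.eval, this, h20]
  · rintro j hj s' ⟨hF, h5, h⟩ h26
    have e9 : s'.nat 9 = s.nat 9 := hF.1 9 (by simp)
    have e10 : s'.nat 10 = s.nat 10 := hF.1 10 (by simp)
    refine WP.setNat ⟨by simpa using h26, (hF.setNat (by simp) _ _ _).setNat (by simp) _ _ _,
      by simpa using h5, ?_⟩ (by decide)
    intro a p
    simp only [NExp.eval, h26, e9, e10, ne_eq, Nat.reduceEqDiff, not_false_eq_true,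
      Mem.setNat_nat_of_ne, Mem.setNat_nat_self]
    split_ifs with hap
    · simp only [true_iff]
      exact ⟨j, by omega, hap.1.symm, hap.2.symm⟩
    · rw [h a p]
      constructor
      · rintro ⟨b, hb, h⟩
        exact ⟨b, by omega, h⟩
      · rintro ⟨b, hb, hx⟩
        refine ⟨b, ?_, hx⟩
        rcases Nat.lt_succ_iff_lt_or_eq.1 hb with hb | rfl
        · exact hb
        · exact absurd ⟨hx.1.symm, hx.2.symm⟩ hap
  · rintro s' - ⟨-, h⟩
    exact h
  · simp only [NExp.cost]
    exact Nat.mul_le_mul (by omega) (by omega)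

/-- The whole program. -/
def openingProgram : Prog :=
  .seq build (.seq insertRows (.ite (.natLE (.var 30) (.const 0)) writeAnswer .skip))

/-- The polynomial that bounds the running time. -/
noncomputable def openingTime : Polynomial ℕ :=
  (.X + 4) * ((.X + 4) * ((.X + 4) * 200)) +
    (((.X + 1) * (.X + 1) + 4) * (((.X + 1) * (.X + 1) + 4) * (((.X + 1) * (.X + 1) + 4) *
      (((.X + 1) * (.X + 1) + 4) * 2000))) + ((.X + 1) * (.X + 1) + 4) * 50)

variable {n m : ℕ} {I : WHA n m} {S : Finset (Fin m)}

/-- Correct answers. -/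
def Correct (I : WHA n m) (S : Finset (Fin m)) (s : Mem) : Prop :=
  (answer s = 1 ∧ I.IsMaxWeightOpening S (output n m s)) ∨
    (answer s = 0 ∧ ¬ ∃ M : Finset (Fin n × Fin m), I.IsMatching M ∧ I.OpensExactly S M)

theorem isMaxWeightOpening_of_matched {adj : ℕ → ℕ → Prop} {w : ℕ → ℕ → ℝ} {x mt : ℕ → ℕ}
    {π : ℕ → ℝ} (h : Matched adj w (n + m * (n + 1)) (m * (n + 1)) x mt π)
    (hadj : ∀ b < m * (n + 1), ∀ c, adj b c ↔ SlotAdj (I.input S) n b c)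
    (hw : ∀ b < m * (n + 1), ∀ c, w b c = slotWeight (I.input S) n b c) :
    I.IsMaxWeightOpening S (slotMatching n m x) := by
  have hx : ∀ b < m * (n + 1), SlotAdj (I.input S) n b (x b) := fun b hb =>
    (hadj b hb _).1 (h.allowed b hb)
  refine ⟨⟨slotMatching_isMatching hx h.inj, slotMatching_opensExactly hx h.inj⟩, ?_⟩
  intro M' hM' hS'
  obtain ⟨z, hz, hinj, rfl⟩ := exists_slots hM' hS'
  have hle := h.sum_le z (fun b hb => ⟨(hz b hb).1, (hadj b hb _).2 (hz b hb).2⟩) hinj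
  have hsum : ∀ y : ℕ → ℕ, ∑ b ∈ Finset.range (m * (n + 1)), w b (y b)
      = ∑ b ∈ Finset.range (m * (n + 1)), slotWeight (I.input S) n b (y b) := fun y =>
    Finset.sum_congr rfl fun b hb => hw b (Finset.mem_range.1 hb) _
  rwa [hsum, hsum, sum_slotWeight hinj, sum_slotWeight h.inj] at hle

theorem openingProgram_spec (I : WHA n m) (S : Finset (Fin m)) :
    WP openingProgram (openingTime.eval (n + m)) (Correct I S) (I.input S) := by
  -- The number of columns, which is at least the number `m * (n + 1)` of rows.
  have hD : n + m * (n + 1) ≤ (n + m + 1) * (n + m + 1) := by nlinarith [Nat.zero_le (n * n)]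
  set D := (n + m + 1) * (n + m + 1) with hDdef
  refine (WP.seq (T := (n + m + 4) * ((n + m + 4) * ((n + m + 4) * 200)))
    (T' := (D + 4) * ((D + 4) * ((D + 4) * ((D + 4) * 2000))) + (D + 4) * 50)
    ((build_spec (I.input S) (n := n) (m := m) (by simp [input]) (by simp [input])
      (by simp [input]) (by simp [input]) (by simp [input])).mono ?_ ?_)).mono ?_ fun _ h => h
  · exact Nat.mul_le_mul (by omega) (Nat.mul_le_mul (by omega) (Nat.mul_le_mul (by omega) le_rfl))
  · rintro s₁ ⟨hB, h21⟩
    have hfr : ∀ k ∉ [8, 9, 20, 21, 31, 32, 33], s₁.nat k = (I.input S).nat k := hB.frame.1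
    refine WP.seq ((insertRows_spec s₁ hB.rows h21 hD (le_trans (by omega) hD) ?_ ?_ ?_ ?_).mono
      le_rfl ?_)
    · rw [hfr 22 (by simp)]; simp [input]
    · rw [hfr 30 (by simp)]; simp [input]
    · rw [hfr 13 (by simp)]; simp [input]
    · rw [hB.frame.2 2 (by simp)]; simp [input]
    · intro s₂ h₂
      refine (WP.ite (T := (m * (n + 1) + 3) * 50) (fun ht => ?_) (fun ht => ?_)).mono ?_
        fun _ h => h
      · simp only [BExp.Holds, NExp.eval, Nat.le_zero] at ht
        rcases h₂ with hR | ⟨r, -, hfail⟩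
        · have e6 : s₂.nat 6 = (I.input S).nat 6 := by
            rw [hR.frame.1 6 (by simp), hfr 6 (by simp)]
          have e9 : s₂.nat 9 = s₁.nat 9 := hR.frame.1 9 (by simp)
          refine (writeAnswer_spec s₂ (N := m * (n + 1)) ?_ ?_).mono le_rfl ?_
          · rw [hR.frame.1 20 (by simp), hB.rows]
          · rw [e6]; simp [input]
          · rintro s₃ ⟨h5, h6⟩
            refine .inl ⟨h5, ?_⟩
            have : output n m s₃ = slotMatching n m (s₂.nat 10 0) := by
              ext ⟨a, p⟩
              simp only [output, Finset.mem_filter, Finset.mem_univ, true_and, h6,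
                mem_slotMatching, e9]
              refine exists_congr fun b => and_congr_right fun hb => ?_
              rw [hB.project b hb]
            rw [this]
            exact isMaxWeightOpening_of_matched hR.matched hB.adj hB.weight
        · exact absurd ht hfail.fail
      · simp only [BExp.Holds, NExp.eval, Nat.le_zero] at ht
        rcases h₂ with hR | ⟨r, hr, hfail⟩
        · exact absurd hR.fail ht
        · refine WP.skip (.inr ⟨?_, ?_⟩) (by omega)
          · rw [answer, hfail.frame.1 5 (by simp), hfr 5 (by simp)]
            simp [input]
          -- A matching would give an assignment of all slots, whose restriction to the rows up to
          -- `r` contradicts the failed insertion.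
          · rintro ⟨M, hM, hS⟩
            obtain ⟨z, hz, hinj, -⟩ := exists_slots hM hS
            refine hfail.not_exists z (fun b hb => ?_)
              fun b hb b' hb' => hinj b (by omega) b' (by omega)
            exact ⟨(hz b (by omega)).1, (hB.adj b (by omega) _).2 (hz b (by omega)).2⟩
      · simp only [BExp.cost, NExp.cost]
        omega
  · simp [openingTime, hDdef]

end WHA

theorem mainTheorem8 :
    ∃ (c : RealRAM.Prog) (q : Polynomial ℕ),
      ∀ (n m : ℕ) (I : WHA n m) (Popen : Finset (Fin m)),
        ∃ (s : RealRAM.Mem) (t : ℕ),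
          RealRAM.Runs c (I.input Popen) s t ∧
          t ≤ q.eval (n + m) ∧
          ((WHA.answer s = 1 ∧ I.IsMaxWeightOpening Popen (WHA.output n m s)) ∨
            (WHA.answer s = 0 ∧
              ¬ ∃ (M : Finset (Fin n × Fin m)), I.IsMatching M ∧ I.OpensExactly Popen M)) :=
  ⟨WHA.openingProgram, WHA.openingTime, fun _ _ I S => WHA.openingProgram_spec I S⟩
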